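/- **Model.** A line network has nodes $v_0,\dots,v_L$ ($L\ge1$) and links $1,\dots,L$, link $i$ joining $v_{i-1}$ to $v_i$. At each time instant $1,2,3,\dots$ one packet is transmitted over every link; a packet on link $i$ is received, without delay, with probability $p_i\in(0,1]$ and lost otherwise, independently over links and instants. Let $p=\min_{1\le i\le L}p_i$. The source $v_0$ holds $k$ message vectors from a vector space $\mathcal F$ over $\mathbb F_2$. A precode (an erasure code) maps them to $k'=q\alpha$ intermediate packets in $\mathcal F$, divided into $q$ disjoint chunks of size $\alpha$. A chunked code is applied to the intermediate packets: at each instant each node $v_{i-1}$, $1\le i\le L$, independently picks a uniformly random chunk and transmits a linear combination over $\mathbb F_2$, with independent uniform coefficients, of the $\alpha$ vectors of the chunk (if it is the source) or of the packets of that chunk it received at earlier instants (otherwise). The sink $v_L$ can decode a chunk once it has received $\alpha$ packets of the chunk whose global encoding vectors in $\mathbb F_2^\alpha$ are linearly independent. The *coding delay* of the chunked code with precoding is the least number of time instants after which the message is determined by the intermediate packets in the decodable chunks ($\infty$ if there is none); it is random through both the code and the losses. Let $0<\gamma_a,\gamma_b<1$ with $\delta:=(1+\gamma_a)\gamma_b<1$.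 A family of precodes indexed by the message size $k$ is *capacity-achieving of rate $1-\delta$* if each of them corrects up to a fraction $\delta$ of erasures (the message is determined by any set of intermediate packets missing at most $\delta k'$ of the $k'$ intermediate packets), and its rate $k/k'$ tends to $1-\delta$ as $k\to\infty$. **Theorem.** There are an absolute constant $C>0$ and a function $g(\gamma_a,\gamma_b)$ that is $O(\gamma_b^2)$ (namely, for every $\eta<1$ there is $K$ with $|g(\gamma_a,\gamma_b)|\le K\gamma_b^2$ whenever $0<\gamma_a,\gamma_b<1$ and $(1+\gamma_a)\gamma_b\le\eta$) such that the following holds. Let $L\ge1$, $p_1,\dots,p_L\in(0,1]$ and $0<\gamma_a,\gamma_b,\gamma_c<1$ with $(1+\gamma_a)\gamma_b<1$ be fixed. For every message size $k$ let a vector space $\mathcal F=\mathcal F_k$, a number $q=q_k\ge 1$ and a size $\alpha=\alpha_k$ of chunks, a precode, and $\epsilon=\epsilon_k\in(0,1)$ be given (for example $\alpha$ and $\epsilon$ constant), such that the precodes form a capacity-achieving family of rate $1-(1+\gamma_a)\gamma_b$, such that for all large $k$ $$\alpha\;\ge\; C\max\left\{\frac{L}{\gamma_c^3}\log\frac{L}{\gamma_b\gamma_c},\;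 L^4\log\frac{L}{\gamma_b}\right\},$$ and such that $$\frac{\alpha^2}{\gamma_a^2\gamma_b^2}=o\!\left(\frac{k}{\log(1/\epsilon)}\right)\qquad(k\to\infty).$$ Then for all sufficiently large $k$ the coding delay of the chunked code with precoding is larger than $$(1+\gamma_c)\bigl(1+(1+\gamma_a)\gamma_b+g(\gamma_a,\gamma_b)\bigr)\frac kp$$ with probability at most $\epsilon$. -/

import Mathlib

open MeasureTheory ProbabilityTheory Filter Topology Asymptotics

namespace ChunkedCode

/-- Everything that is random about the transmission over one link at time instant `t`:
* whether the packet is successful (`true`) or lost (`false`);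
* the chunk to which the transmitted packet pertains;
* if the transmitting node is the source: the coefficients of the `α` vectors of that chunk;
* if the transmitting node is an interior node: a coefficient for each of the `t` earlier instants
  `s < t`, to be used if a packet of the same chunk was received by the node at instant `s`.

There are `q` chunks of size `α`. The time instants are numbered `0, 1, 2, …`. -/
abbrev Slot (q α t : ℕ) : Type := Bool × Fin q × (Fin α → ZMod 2) × (Fin t → ZMod 2)

/-- The law of a slot: the packet is successful with probability `p`, the chunk and all the
coefficients are uniformly distributed, and everything is independent. -/
noncomputable def slotLaw (q α t : ℕ) (p : unitInterval) : Measure (Slot q α t) :=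
  (bernoulliMeasure true false p).prod
    ((uniformOn (Set.univ : Set (Fin q))).prod
      ((uniformOn (Set.univ : Set (Fin α → ZMod 2))).prod
        (uniformOn (Set.univ : Set (Fin t → ZMod 2)))))

instance (q α t : ℕ) [NeZero q] (p : unitInterval) : IsProbabilityMeasure (slotLaw q α t p) := by
  have : IsProbabilityMeasure (uniformOn (Set.univ : Set (Fin q))) :=
    isProbabilityMeasure_uniformOn Set.finite_univ Set.univ_nonempty
  have : IsProbabilityMeasure (uniformOn (Set.univ : Set (Fin α → ZMod 2))) :=
    isProbabilityMeasure_uniformOn Set.finite_univ Set.univ_nonempty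
  have : IsProbabilityMeasure (uniformOn (Set.univ : Set (Fin t → ZMod 2))) :=
    isProbabilityMeasure_uniformOn Set.finite_univ Set.univ_nonempty
  unfold slotLaw
  infer_instance

/-- A realization of the code and of the traffic on a line network of `L` links: one slot for each
link (numbered `0, …, L - 1`, link `i` joining node `i` to node `i + 1`) and each time instant. -/
abbrev Outcome (L q α : ℕ) : Type := (x : Fin L × ℕ) → Slot q α x.2

/-- The law of a randomly chosen chunked code over a randomly chosen traffic with deterministic
regular transmissions and Bernoulli losses of success parameters `p i`: all slots are
independent. -/
noncomputable def law (L q α : ℕ) [NeZero q] (p : Fin L → unitInterval) :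
    Measure (Outcome L q α) :=
  Measure.infinitePi fun x : Fin L × ℕ => slotLaw q α x.2 (p x.1)

section Network

variable {L q α : ℕ} (ω : Outcome L q α)

/-- The packet transmitted over link `i` at instant `t` arrives. -/
def Success (i : Fin L) (t : ℕ) : Prop := (ω (i, t)).1 = true

/-- The chunk to which the packet transmitted over link `i` at instant `t` pertains. -/
def chunk (i : Fin L) (t : ℕ) : Fin q := (ω (i, t)).2.1

/-- The coefficients that the source uses at instant `t` (meaningful for the first link). -/
def sourceCoeff (i : Fin L) (t : ℕ) : Fin α → ZMod 2 := (ω (i, t)).2.2.1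

/-- The coefficients that the interior node at the start of link `i` uses at instant `t`. -/
def relayCoeff (i : Fin L) (t : ℕ) : Fin t → ZMod 2 := (ω (i, t)).2.2.2

open Classical in
/-- The global encoding vector, with respect to the `α` vectors of its chunk, of the packet
transmitted over link `i` at instant `t`. The source combines all the vectors of the chunk; an
interior node combines the packets of the chunk that it received at earlier instants. -/
noncomputable def encodingVector : (i : ℕ) → i < L → ℕ → (Fin α → ZMod 2)
  | 0, h, t => sourceCoeff ω ⟨0, h⟩ t
  | i + 1, h, t => ∑ s : Fin t,
      if Success ω ⟨i, Nat.lt_of_succ_lt h⟩ s ∧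
          chunk ω ⟨i, Nat.lt_of_succ_lt h⟩ s = chunk ω ⟨i + 1, h⟩ t then
        relayCoeff ω ⟨i + 1, h⟩ t s • encodingVector i (Nat.lt_of_succ_lt h) s
      else 0

/-- After the first `n` time instants the sink can decode chunk `c`: the packets of the chunk that
it received contain `α` packets with linearly independent global encoding vectors. -/
def ChunkDecodable [NeZero L] (n : ℕ) (c : Fin q) : Prop :=
  ∃ s : Fin α → ℕ,
    (∀ j, s j < n ∧ Success ω ⟨L - 1, Nat.sub_one_lt (NeZero.ne L)⟩ (s j) ∧
      chunk ω ⟨L - 1, Nat.sub_one_lt (NeZero.ne L)⟩ (s j) = c) ∧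
    LinearIndependent (ZMod 2) fun j =>
      encodingVector ω (L - 1) (Nat.sub_one_lt (NeZero.ne L)) (s j)

end Network

/-- A precode maps the `k` message vectors in `F` to `q * α` intermediate packets in `F`, arranged
in `q` chunks of size `α`. -/
abbrev Precode (k q α : ℕ) (F : Type*) : Type _ := (Fin k → F) → (Fin q × Fin α → F)

/-- The precode can correct up to a fraction `δ` of erasures: the message is determined by any
family of intermediate packets that misses at most this fraction of them. -/
def Precode.CorrectsErasures {k q α : ℕ} {F : Type*} (E : Precode k q α F) (δ : ℝ) : Prop :=
  ∀ R : Finset (Fin q × Fin α), ((Rᶜ.card : ℕ) : ℝ) ≤ δ * ((q : ℝ) * (α : ℝ)) →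
    Function.Injective fun (x : Fin k → F) (j : R) => E x j

/-- After the first `n` time instants the sink can recover all the message vectors: they are
determined by the intermediate packets in the decodable chunks. -/
def MessageRecoverable {L k q α : ℕ} [NeZero L] {F : Type*} (E : Precode k q α F)
    (ω : Outcome L q α) (n : ℕ) : Prop :=
  Function.Injective
    fun (x : Fin k → F) (j : {j : Fin q × Fin α // ChunkDecodable ω n j.1}) => E x j

/-- The coding delay of the chunked code with precode `E`: the least number of time instants after
which the sink can recover the message (`⊤` if this never happens). -/
noncomputable def codingDelay {L k q α : ℕ} [NeZero L] {F : Type*} (E : Precode k q α F)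
    (ω : Outcome L q α) : ℕ∞ :=
  ⨅ (n : ℕ) (_ : MessageRecoverable E ω n), (n : ℕ∞)

end ChunkedCode

/-! Fix a chunk and a nonzero vector `v`. A node holding a packet of the chunk not orthogonal to `v`
sends over the next link packets of the chunk whose product with `v` is a fair coin, because
flipping one coefficient flips the product. Hence a walk that advances at every arrival not
orthogonal to `v` passes each link as soon as a fair coin succeeds. If `f` counts the failures and
`i` the node reached, then `a ^ f * b ^ i` with `a + b = 2` is a supermartingale
(`lintegral_weight_walk_le_one`). By Markov, `m` failures before the sink have probability at most
about `(2 - b) ^ (-m)`, which for `m` slightly above `α` beats a union bound over the `2 ^ α`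
vectors. By duality the chunk is decodable once all these walks have reached the sink.

To force `m` failures on a walk that stays short of the sink, time is cut into `W` windows. A
Chernoff bound gives about `α / W` arrivals per link and window; a walk advances in fewer than `L`
windows and counts all arrivals in the others (`le_snd_walk_of_windows`). So a chunk fails with
probability at most `γb` (`exists_windows_law_not_chunkDecodable_le`).

Changing one slot affects at most two chunks, so by bounded differences the number of undecodable
chunks rarely exceeds `(1 + γa) * γb * q`, and the precode repairs that many. The precode rate
contributes the factor `1 / (1 - δ) = 1 + δ + O(δ ^ 2)` to the delay. -/

/-! ### Resampling a coordinate; the bounded differences inequality -/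

section Resampling

variable {ι : Type*} [DecidableEq ι] {X : ι → Type*} [∀ i, MeasurableSpace (X i)]
  (μ : ∀ i, Measure (X i)) [∀ i, IsProbabilityMeasure (μ i)]

/-- Resampling one coordinate does not change a product measure. -/
theorem measurePreserving_update_infinitePi (j : ι) :
    MeasurePreserving (fun z : (∀ i, X i) × X j => Function.update z.1 j z.2)
      ((Measure.infinitePi μ).prod (μ j)) (Measure.infinitePi μ) := by
  refine ⟨measurable_update', ?_⟩
  refine Measure.eq_infinitePi μ fun s t ht => ?_
  rw [Measure.map_apply measurable_update' (MeasurableSet.pi s.countable_toSet fun i _ => ht i)]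
  have hpre : (fun z : (∀ i, X i) × X j => Function.update z.1 j z.2) ⁻¹' (s : Set ι).pi t =
      (((s.erase j : Finset ι) : Set ι).pi t) ×ˢ (if j ∈ s then t j else Set.univ) := by
    ext ⟨x, y⟩
    simp only [Set.mem_preimage, Set.mem_pi, Set.mem_prod, Finset.mem_coe, Finset.mem_erase]
    constructor
    · intro h
      refine ⟨fun i hi => by simpa [hi.1] using h i hi.2, ?_⟩
      split_ifs with hj
      · simpa using h j hj
      · trivial
    · rintro ⟨h1, h2⟩ i hi
      by_cases hij : i = j
      · subst hij
        simpa [hi] using h2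
      · simpa [hij] using h1 i ⟨hij, hi⟩
  rw [hpre, Measure.prod_prod, Measure.infinitePi_pi μ fun i _ => ht i]
  split_ifs with hj
  · exact Finset.prod_erase_mul s _ hj
  · rw [Finset.erase_eq_of_notMem hj, measure_univ, mul_one]

theorem lintegral_infinitePi_eq_lintegral_update (j : ι) {f : (∀ i, X i) → ENNReal}
    (hf : Measurable f) :
    ∫⁻ ω, f ω ∂Measure.infinitePi μ =
      ∫⁻ ω, ∫⁻ x, f (Function.update ω j x) ∂μ j ∂Measure.infinitePi μ := by
  rw [← (measurePreserving_update_infinitePi μ j).lintegral_comp hf]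
  exact lintegral_prod _ (hf.comp measurable_update').aemeasurable

theorem integral_infinitePi_eq_integral_update (j : ι) {f : (∀ i, X i) → ℝ} {B : ℝ}
    (hf : Measurable f) (hB : ∀ ω, |f ω| ≤ B) :
    ∫ ω, f ω ∂Measure.infinitePi μ =
      ∫ ω, ∫ x, f (Function.update ω j x) ∂μ j ∂Measure.infinitePi μ := by
  have hmp := measurePreserving_update_infinitePi μ j
  rw [← hmp.map_eq, integral_map hmp.measurable.aemeasurable hf.aestronglyMeasurable, hmp.map_eq]
  exact integral_prod _ (Integrable.of_bound
    (hf.comp measurable_update').aestronglyMeasurable B (.of_forall fun z => hB _))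

/-- The moment generating function of a function with bounded differences of finitely many
independent variables. -/
theorem integral_exp_sub_integral_le_of_abs_update_sub_le {c : ℝ} (s : ℝ) (S : Finset ι) :
    ∀ {f : (∀ i, X i) → ℝ} {B : ℝ}, Measurable f → (∀ ω, |f ω| ≤ B) → DependsOn f S →
      (∀ ω j x, |f (Function.update ω j x) - f ω| ≤ c) →
      ∫ ω, Real.exp (s * (f ω - ∫ ω', f ω' ∂Measure.infinitePi μ)) ∂Measure.infinitePi μ ≤
        Real.exp (S.card * (c ^ 2 * s ^ 2 / 2)) := by
  induction S using Finset.induction_on with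
  | empty =>
    intro f B hf hB hdep hc
    obtain ⟨ω₀⟩ := nonempty_of_isProbabilityMeasure (Measure.infinitePi μ)
    have hconst : ∀ ω, f ω = f ω₀ := fun ω => hdep fun i hi => by simp at hi
    simp [hconst]
  | insert j S hj ih =>
    intro f B hf hB hdep hc
    set P := Measure.infinitePi μ
    obtain ⟨ω₀⟩ := nonempty_of_isProbabilityMeasure P
    have hc0 : 0 ≤ c := (abs_nonneg _).trans (hc ω₀ j (ω₀ j))
    -- Averaging out coordinate `j` keeps the mean, the bound and the bounded differences, and
    -- leaves a function of the coordinates in `S`.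
    set g : (∀ i, X i) → ℝ := fun ω => ∫ x, f (Function.update ω j x) ∂μ j with hg
    have hfu : Measurable fun z : (∀ i, X i) × X j => f (Function.update z.1 j z.2) :=
      hf.comp measurable_update'
    have hfu' : ∀ ω, Measurable fun x : X j => f (Function.update ω j x) :=
      fun ω => hf.comp (measurable_update ω)
    have hint : ∀ ω, Integrable (fun x => f (Function.update ω j x)) (μ j) := fun ω =>
      Integrable.of_bound (hfu' ω).aestronglyMeasurable B (.of_forall fun x => hB _)
    have hgm : Measurable g := hfu.stronglyMeasurable.integral_prod_right'.measurable
    have hgB : ∀ ω, |g ω| ≤ B := fun ω => by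
      simpa using norm_integral_le_of_norm_le_const (μ := μ j)
        (f := fun x => f (Function.update ω j x)) (C := B) (.of_forall fun x => hB _)
    have hgdep : DependsOn g S := fun ω ω' h => by
      simp only [hg]
      congr 1
      ext x
      refine hdep fun i hi => ?_
      by_cases hij : i = j
      · subst hij; simp
      · simpa [hij] using h i (by simpa [hij] using hi)
    have hgc : ∀ ω i x, |g (Function.update ω i x) - g ω| ≤ c := fun ω i x => by
      by_cases hij : i = j
      · subst hij; simpa [hg] using hc0
      · change |∫ y, f (Function.update (Function.update ω i x) j y) ∂μ j -
          ∫ y, f (Function.update ω j y) ∂μ j| ≤ c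
        rw [← integral_sub (hint _) (hint _)]
        have hdiff : ∀ y, ‖f (Function.update (Function.update ω i x) j y) -
            f (Function.update ω j y)‖ ≤ c := fun y => by
          rw [Function.update_comm hij]
          exact hc _ _ _
        simpa using norm_integral_le_of_norm_le_const (μ := μ j) (.of_forall hdiff)
    have hgf : ∫ ω, g ω ∂P = ∫ ω, f ω ∂P :=
      (integral_infinitePi_eq_integral_update μ j hf hB).symm
    set m := ∫ ω, f ω ∂P
    have hexpB : ∀ {h : (∀ i, X i) → ℝ}, (∀ ω, |h ω| ≤ B) → ∀ ω,
        |Real.exp (s * (h ω - m))| ≤ Real.exp (|s| * (B + |m|)) := fun hh ω => by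
      rw [abs_of_pos (Real.exp_pos _), Real.exp_le_exp]
      refine (le_abs_self _).trans ?_
      rw [abs_mul]
      gcongr
      exact (abs_sub _ _).trans (by gcongr; exact hh ω)
    have hinner : ∀ ω, ∫ x, Real.exp (s * (f (Function.update ω j x) - m)) ∂μ j ≤
        Real.exp (c ^ 2 * s ^ 2 / 2) * Real.exp (s * (g ω - m)) := fun ω => by
      -- Hoeffding's lemma for coordinate `j` alone: its values lie in an interval of length `2 *
      -- c`, which gives the variance parameter `c ^ 2`.
      have hsub := (hasSubgaussianMGF_of_mem_Icc (μ := μ j) (a := f ω - c) (b := f ω + c)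
        (hfu' ω).aemeasurable (.of_forall fun x => by
          have := abs_le.1 (hc ω j x)
          constructor <;> linarith)).mgf_le s
      have h1 : ((((‖(f ω + c) - (f ω - c)‖₊ / 2) ^ 2 : NNReal)) : ℝ) = c ^ 2 := by
        push_cast
        rw [Real.norm_eq_abs, abs_of_nonneg (by linarith)]
        ring
      rw [h1, mgf] at hsub
      have h2 : ∀ x, Real.exp (s * (f (Function.update ω j x) - m)) =
          Real.exp (s * (f (Function.update ω j x) - g ω)) * Real.exp (s * (g ω - m)) := fun x => by
        rw [← Real.exp_add]; ring_nf
      simp_rw [h2]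
      rw [integral_mul_const]
      exact mul_le_mul_of_nonneg_right hsub (Real.exp_pos _).le
    have hmeas : ∀ {h : (∀ i, X i) → ℝ}, Measurable h →
        Measurable fun ω => Real.exp (s * (h ω - m)) := fun hh => by fun_prop
    have hgint : Integrable (fun ω => Real.exp (s * (g ω - m))) P :=
      Integrable.of_bound (hmeas hgm).aestronglyMeasurable _ (.of_forall (hexpB hgB))
    calc ∫ ω, Real.exp (s * (f ω - m)) ∂P
        = ∫ ω, ∫ x, Real.exp (s * (f (Function.update ω j x) - m)) ∂μ j ∂P :=
          integral_infinitePi_eq_integral_update μ j (hmeas hf) (hexpB hB)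
      _ ≤ ∫ ω, Real.exp (c ^ 2 * s ^ 2 / 2) * Real.exp (s * (g ω - m)) ∂P :=
          integral_mono_of_nonneg
            (.of_forall fun ω => integral_nonneg fun x => (Real.exp_pos _).le)
            (hgint.const_mul _) (.of_forall hinner)
      _ = Real.exp (c ^ 2 * s ^ 2 / 2) * ∫ ω, Real.exp (s * (g ω - m)) ∂P :=
          integral_const_mul _ _
      _ ≤ Real.exp (c ^ 2 * s ^ 2 / 2) * Real.exp (S.card * (c ^ 2 * s ^ 2 / 2)) := by
          gcongr
          simpa only [hgf] using ih hgm hgB hgdep hgc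
      _ = _ := by
          rw [← Real.exp_add, Finset.card_insert_of_notMem hj]
          push_cast
          ring_nf

/-- The bounded differences inequality. -/
theorem measureReal_ge_le_of_abs_update_sub_le {c : ℝ} {S : Finset ι} {f : (∀ i, X i) → ℝ} {B : ℝ}
    (hf : Measurable f) (hB : ∀ ω, |f ω| ≤ B) (hdep : DependsOn f S)
    (hc : ∀ ω j x, |f (Function.update ω j x) - f ω| ≤ c) {u : ℝ} (hu : 0 ≤ u) :
    (Measure.infinitePi μ).real {ω | u ≤ f ω - ∫ ω', f ω' ∂Measure.infinitePi μ} ≤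
      Real.exp (-u ^ 2 / (2 * (S.card * c ^ 2))) := by
  have hsub : HasSubgaussianMGF (fun ω => f ω - ∫ ω', f ω' ∂Measure.infinitePi μ)
      (S.card * (c ^ 2).toNNReal) (Measure.infinitePi μ) := by
    refine ⟨fun s => ?_, fun s => ?_⟩
    · refine Integrable.of_bound (by fun_prop)
        (Real.exp (|s| * (B + |∫ ω', f ω' ∂Measure.infinitePi μ|))) (.of_forall fun ω => ?_)
      rw [Real.norm_eq_abs, abs_of_pos (Real.exp_pos _), Real.exp_le_exp]
      refine (le_abs_self _).trans ?_
      rw [abs_mul]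
      gcongr
      exact (abs_sub _ _).trans (by gcongr; exact hB ω)
    · refine (integral_exp_sub_integral_le_of_abs_update_sub_le μ s S hf hB hdep hc).trans_eq ?_
      push_cast
      rw [Real.coe_toNNReal _ (sq_nonneg c)]
      ring_nf
  simpa [Real.coe_toNNReal _ (sq_nonneg c)] using hsub.measure_ge_le hu

end Resampling

/-- A function of finitely many discrete coordinates is measurable. -/
theorem DependsOn.measurable_of_finite {ι : Type*} {X : ι → Type*} [∀ i, MeasurableSpace (X i)]
    [∀ i, Finite (X i)] [∀ i, MeasurableSingletonClass (X i)] {β : Type*} [MeasurableSpace β]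
    [Nonempty β] {f : (∀ i, X i) → β} {S : Set ι} (hS : S.Finite) (hf : DependsOn f S) :
    Measurable f := by
  obtain ⟨g, rfl⟩ := dependsOn_iff_exists_comp.1 hf
  have := hS.to_subtype
  exact (Measurable.of_discrete (f := g)).comp (measurable_pi_lambda _ fun i => measurable_pi_apply _)

namespace ChunkedCode

/-! ### Locality in chunks and in time -/

section Locality

variable {L q α : ℕ}

/-- The encoding vectors of the packets of a chunk depend only on the slots of this chunk. -/
theorem encodingVector_congr_of_chunk {c : Fin q} {ω ω' : Outcome L q α}
    (h : ∀ y : Fin L × ℕ, ω y = ω' y ∨ ((ω y).2.1 ≠ c ∧ (ω' y).2.1 ≠ c)) :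
    ∀ (i : ℕ) (hi : i < L) (t : ℕ), chunk ω ⟨i, hi⟩ t = c →
      encodingVector ω i hi t = encodingVector ω' i hi t := by
  intro i
  induction i with
  | zero =>
    intro hi t hc
    rcases h (⟨0, hi⟩, t) with h1 | h1
    · simp only [encodingVector, sourceCoeff, h1]
    · exact absurd hc h1.1
  | succ i ih =>
    intro hi t hc
    rcases h (⟨i + 1, hi⟩, t) with h1 | h1
    · simp only [encodingVector]
      have hc' : chunk ω' ⟨i + 1, hi⟩ t = c := by rw [← hc, chunk, chunk, h1]
      refine Finset.sum_congr rfl fun s _ => ?_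
      rw [hc, hc']
      have hr : relayCoeff ω ⟨i + 1, hi⟩ t = relayCoeff ω' ⟨i + 1, hi⟩ t := by
        simp only [relayCoeff, h1]
      -- A slot where the outcomes differ belongs to another chunk in both, so its summand vanishes
      -- in both.
      rcases h (⟨i, Nat.lt_of_succ_lt hi⟩, s) with h2 | h2
      · by_cases hcs : chunk ω ⟨i, Nat.lt_of_succ_lt hi⟩ s = c
        · have hcs' : chunk ω' ⟨i, Nat.lt_of_succ_lt hi⟩ s = c := by rw [← hcs, chunk, chunk, h2]
          simp only [Success, hcs, hcs', h2, hr, ih _ _ hcs]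
        · have hcs' : chunk ω' ⟨i, Nat.lt_of_succ_lt hi⟩ s ≠ c := by
            rwa [chunk, ← h2]
          simp only [hcs, hcs', and_false, if_false]
      · simp only [chunk, h2.1, h2.2, and_false, if_false]
    · exact absurd hc h1.1

theorem ChunkDecodable.congr_of_chunk [NeZero L] {c : Fin q} {ω ω' : Outcome L q α}
    (h : ∀ y : Fin L × ℕ, ω y = ω' y ∨ ((ω y).2.1 ≠ c ∧ (ω' y).2.1 ≠ c)) {n : ℕ}
    (hd : ChunkDecodable ω n c) : ChunkDecodable ω' n c := by
  obtain ⟨s, hs, hli⟩ := hd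
  refine ⟨s, fun j => ?_, ?_⟩
  · obtain ⟨h1, h2, h3⟩ := hs j
    rcases h (⟨L - 1, Nat.sub_one_lt (NeZero.ne L)⟩, s j) with h4 | h4
    · exact ⟨h1, by rwa [Success, ← h4], by rwa [chunk, ← h4]⟩
    · exact absurd h3 h4.1
  · convert hli using 2 with j
    exact (encodingVector_congr_of_chunk h _ _ _ (hs j).2.2).symm

/-- The encoding vector of a packet depends only on its slot and the earlier slots. -/
theorem encodingVector_congr_of_time {ω ω' : Outcome L q α} :
    ∀ (i : ℕ) (hi : i < L) (t : ℕ), (∀ y : Fin L × ℕ, y.2 < t → ω y = ω' y) →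
      ω (⟨i, hi⟩, t) = ω' (⟨i, hi⟩, t) → encodingVector ω i hi t = encodingVector ω' i hi t := by
  intro i
  induction i with
  | zero =>
    intro hi t _ h1
    simp only [encodingVector, sourceCoeff, h1]
  | succ i ih =>
    intro hi t h h1
    simp only [encodingVector]
    refine Finset.sum_congr rfl fun s _ => ?_
    rw [ih _ s (fun y hy => h y (hy.trans s.2)) (h _ s.2)]
    simp only [Success, chunk, relayCoeff, h1,
      h (⟨i, Nat.lt_of_succ_lt hi⟩, (s : ℕ)) s.2]
    congr

theorem ChunkDecodable.congr_of_time [NeZero L] {c : Fin q} {ω ω' : Outcome L q α} {n : ℕ}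
    (h : ∀ y : Fin L × ℕ, y.2 < n → ω y = ω' y) (hd : ChunkDecodable ω n c) :
    ChunkDecodable ω' n c := by
  obtain ⟨s, hs, hli⟩ := hd
  refine ⟨s, fun j => ?_, ?_⟩
  · obtain ⟨h1, h2, h3⟩ := hs j
    have h4 := h (⟨L - 1, Nat.sub_one_lt (NeZero.ne L)⟩, s j) h1
    exact ⟨h1, by rwa [Success, ← h4], by rwa [chunk, ← h4]⟩
  · convert hli using 2 with j
    exact (encodingVector_congr_of_time _ _ _ (fun y hy => h y (hy.trans (hs j).1))
      (h _ (hs j).1)).symm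

end Locality

/-! ### Decodability by duality -/

/-- A set of vectors such that no nonzero vector is orthogonal to all of them contains a basis. -/
theorem exists_linearIndependent_of_forall_dotProduct_ne_zero {K : Type*} [Field K] {α : ℕ}
    {S : Set (Fin α → K)} (hS : ∀ v : Fin α → K, v ≠ 0 → ∃ u ∈ S, dotProduct v u ≠ 0) :
    ∃ u : Fin α → (Fin α → K), (∀ j, u j ∈ S) ∧ LinearIndependent K u := by
  have hspan : Submodule.span K S = ⊤ := by
    -- A proper span lies in the kernel of a nonzero functional, which is the dot product with a
    -- nonzero vector.
    by_contra hne
    obtain ⟨f, hf0, hf⟩ := Submodule.exists_le_ker_of_lt_top _ (lt_top_iff_ne_top.2 hne)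
    have hfv : ∀ u, dotProduct (fun j => f (Pi.single j 1)) u = f u := fun u => by
      conv_rhs => rw [pi_eq_sum_univ' u]
      simp [dotProduct, mul_comm]
    have hv : (fun j => f (Pi.single j (1 : K))) ≠ 0 := fun h0 => hf0 (LinearMap.ext fun u => by
      rw [← hfv u, h0]; simp)
    obtain ⟨u, hu, hne⟩ := hS _ hv
    exact hne ((hfv u).trans (hf (Submodule.subset_span hu)))
  obtain ⟨b, hbS, hb, hli⟩ := exists_linearIndependent K S
  let B : Module.Basis b K (Fin α → K) := Module.Basis.mk hli (by simp [hb, hspan])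
  have e : Fin α ≃ b := (Pi.basisFun K (Fin α)).indexEquiv B
  exact ⟨fun j => e j, fun j => hbS (e j).2, hli.comp e e.injective⟩

/-- Reduces decodability to one test vector `v` at a time, at the price of a union bound over all
`v`. -/
theorem chunkDecodable_of_forall_dotProduct_ne_zero {L q α : ℕ} [NeZero L] {ω : Outcome L q α}
    {n : ℕ} {c : Fin q}
    (h : ∀ v : Fin α → ZMod 2, v ≠ 0 → ∃ s < n,
      Success ω ⟨L - 1, Nat.sub_one_lt (NeZero.ne L)⟩ s ∧
      chunk ω ⟨L - 1, Nat.sub_one_lt (NeZero.ne L)⟩ s = c ∧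
      dotProduct v (encodingVector ω (L - 1) (Nat.sub_one_lt (NeZero.ne L)) s) ≠ 0) :
    ChunkDecodable ω n c := by
  obtain ⟨u, hu, hli⟩ := exists_linearIndependent_of_forall_dotProduct_ne_zero
    (S := {u | ∃ s < n, Success ω ⟨L - 1, Nat.sub_one_lt (NeZero.ne L)⟩ s ∧
      chunk ω ⟨L - 1, Nat.sub_one_lt (NeZero.ne L)⟩ s = c ∧
      encodingVector ω (L - 1) (Nat.sub_one_lt (NeZero.ne L)) s = u}) fun v hv => by
    obtain ⟨s, h1, h2, h3, h4⟩ := h v hv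
    exact ⟨_, ⟨s, h1, h2, h3, rfl⟩, h4⟩
  choose s h1 h2 h3 h4 using hu
  exact ⟨s, fun j => ⟨h1 j, h2 j, h3 j⟩, by simpa only [h4] using hli⟩

/-! ### The law of one slot -/

section SlotLaw

variable {q α t : ℕ} [NeZero q]

theorem isProbabilityMeasure_uniformOn_univ (β : Type*) [MeasurableSpace β] [Finite β] [Nonempty β]
    [MeasurableSingletonClass β] : IsProbabilityMeasure (uniformOn (Set.univ : Set β)) :=
  isProbabilityMeasure_uniformOn Set.finite_univ Set.univ_nonempty

theorem measurePreserving_uniformOn_univ {β : Type*} [MeasurableSpace β] [Finite β] [Nonempty β]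
    [DiscreteMeasurableSpace β] (e : β ≃ β) :
    MeasurePreserving e (uniformOn (Set.univ : Set β)) (uniformOn (Set.univ : Set β)) := by
  have := Fintype.ofFinite β
  refine ⟨.of_discrete, Measure.ext fun s _ => ?_⟩
  rw [Measure.map_apply .of_discrete .of_discrete, uniformOn_univ, uniformOn_univ,
    ← e.image_symm_eq_preimage, Measure.count_injective_image e.symm.injective]

/-- Translating the coefficients preserves the law of a slot. -/
theorem measurePreserving_slotLaw_translate (p : unitInterval) (u : Fin α → ZMod 2)
    (u' : Fin t → ZMod 2) :
    MeasurePreserving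
      (fun x : Slot q α t => ((x.1, x.2.1, x.2.2.1 + u, x.2.2.2 + u') : Slot q α t))
      (slotLaw q α t p) (slotLaw q α t p) := by
  have := isProbabilityMeasure_uniformOn_univ (Fin q)
  have := isProbabilityMeasure_uniformOn_univ (Fin α → ZMod 2)
  have := isProbabilityMeasure_uniformOn_univ (Fin t → ZMod 2)
  exact (MeasurePreserving.id _).prod ((MeasurePreserving.id _).prod
    ((measurePreserving_uniformOn_univ (Equiv.addRight u)).prod
      (measurePreserving_uniformOn_univ (Equiv.addRight u'))))

/-- The probability that a packet of a given chunk arrives. -/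
theorem slotLaw_arrival (p : unitInterval) (c : Fin q) :
    slotLaw q α t p {x | x.1 = true ∧ x.2.1 = c} = ENNReal.ofReal (p / q) := by
  have := isProbabilityMeasure_uniformOn_univ (Fin q)
  have := isProbabilityMeasure_uniformOn_univ (Fin α → ZMod 2)
  have := isProbabilityMeasure_uniformOn_univ (Fin t → ZMod 2)
  have hset : {x : Slot q α t | x.1 = true ∧ x.2.1 = c} =
      {true} ×ˢ ({c} ×ˢ (Set.univ : Set ((Fin α → ZMod 2) × (Fin t → ZMod 2)))) := by
    ext x; simp
  have hq : (0 : ℝ) < q := by exact_mod_cast NeZero.pos q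
  rw [hset, slotLaw, Measure.prod_prod, Measure.prod_prod, measure_univ, mul_one, uniformOn_univ,
    bernoulliMeasure_apply_of_mem_of_notMem p (by simp) (by simp) (by simp),
    Measure.count_singleton, Fintype.card_fin, ENNReal.ofReal_div_of_pos hq, ENNReal.ofReal_natCast,
    div_eq_mul_inv, div_eq_mul_inv, one_mul]
  congr 1
  exact (ENNReal.ofReal_eq_coe_nnreal p.2.1).symm

open Classical in
/-- The moment generating function of the indicator of an arrival. -/
theorem lintegral_slotLaw_arrival_le (p : unitInterval) (c : Fin q) {θ : ℝ} (hθ : 0 ≤ θ) :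
    ∫⁻ x, (if x.1 = true ∧ x.2.1 = c then ENNReal.ofReal θ else 1) ∂slotLaw q α t p ≤
      ENNReal.ofReal (Real.exp (-(p / q * (1 - θ)))) := by
  set A : Set (Slot q α t) := {x | x.1 = true ∧ x.2.1 = c}
  have hA : MeasurableSet A := .of_discrete
  have hp1 : (p : ℝ) / q ≤ 1 :=
    (div_le_self p.2.1 (by exact_mod_cast NeZero.one_le)).trans p.2.2
  have hp0 : 0 ≤ (p : ℝ) / q := div_nonneg p.2.1 (Nat.cast_nonneg q)
  have h1 : ∀ x : Slot q α t, (if x.1 = true ∧ x.2.1 = c then ENNReal.ofReal θ else 1) =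
      A.indicator (fun _ => ENNReal.ofReal θ) x + Aᶜ.indicator (fun _ => 1) x := fun x => by
    by_cases hx : x ∈ A
    · have hx' : x.1 = true ∧ x.2.1 = c := hx
      simp [hx, hx']
    · have hx' : ¬ (x.1 = true ∧ x.2.1 = c) := hx
      rw [if_neg hx', Set.indicator_of_notMem hx, Set.indicator_of_mem (by exact hx), zero_add]
  simp_rw [h1]
  rw [lintegral_add_left .of_discrete, lintegral_indicator_const hA,
    lintegral_indicator_const hA.compl, prob_compl_eq_one_sub hA, slotLaw_arrival, one_mul,
    ← ENNReal.ofReal_one, ← ENNReal.ofReal_sub _ hp0, ← ENNReal.ofReal_mul hθ,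
    ← ENNReal.ofReal_add (mul_nonneg hθ hp0) (by linarith)]
  refine ENNReal.ofReal_le_ofReal ?_
  -- The integral is `1 - p / q * (1 - θ)`, so `1 - y ≤ exp (-y)` suffices.
  have := Real.add_one_le_exp (-((p : ℝ) / q * (1 - θ)))
  linarith

end SlotLaw

/-! ### The walk attached to a chunk and a test vector -/

section Walk

variable {L q α : ℕ}

/-- A packet of chunk `c` arrives over link `i` at instant `t`. -/
def Arrives (ω : Outcome L q α) (c : Fin q) (i : Fin L) (t : ℕ) : Prop :=
  Success ω i t ∧ chunk ω i t = c

open Classical in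
/-- One step of `walk`. -/
noncomputable def walkStep (ω : Outcome L q α) (c : Fin q) (v : Fin α → ZMod 2) (t : ℕ)
    (z : ℕ × ℕ) : ℕ × ℕ :=
  if h : z.1 < L then
    if Arrives ω c ⟨z.1, h⟩ t then
      if dotProduct v (encodingVector ω z.1 h t) = 0 then (z.1, z.2 + 1) else (z.1 + 1, z.2)
    else z
  else z

/-- A walk along the line network that advances from node `i` when a packet of chunk `c` whose
encoding vector is not orthogonal to `v` arrives over link `i`. The first component is the node
reached before instant `t`, the second one counts the packets of the chunk that arrived over the
link ahead of the walk, but were orthogonal to `v`. -/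
noncomputable def walk (ω : Outcome L q α) (c : Fin q) (v : Fin α → ZMod 2) : ℕ → ℕ × ℕ
  | 0 => (0, 0)
  | t + 1 => walkStep ω c v t (walk ω c v t)

variable {ω ω' : Outcome L q α} {c : Fin q} {v : Fin α → ZMod 2} {t : ℕ}

theorem walkStep_congr {z : ℕ × ℕ} (h : ∀ y : Fin L × ℕ, y.2 < t + 1 → ω y = ω' y) :
    walkStep ω c v t z = walkStep ω' c v t z := by
  unfold walkStep
  by_cases hz : z.1 < L
  · have h1 := h (⟨z.1, hz⟩, t) t.lt_succ_self
    rw [dif_pos hz, dif_pos hz, encodingVector_congr_of_time z.1 hz t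
      (fun y hy => h y (hy.trans t.lt_succ_self)) h1]
    simp only [Arrives, Success, chunk, h1]
    congr
  · rw [dif_neg hz, dif_neg hz]

theorem walk_congr : ∀ {t : ℕ}, (∀ y : Fin L × ℕ, y.2 < t → ω y = ω' y) →
    walk ω c v t = walk ω' c v t
  | 0, _ => rfl
  | t + 1, h => by
    rw [walk, walk, walk_congr fun y hy => h y (hy.trans t.lt_succ_self), walkStep_congr h]

theorem walkStep_of_not_arrives {z : ℕ × ℕ} (hz : z.1 < L) (h : ¬ Arrives ω c ⟨z.1, hz⟩ t) :
    walkStep ω c v t z = z := by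
  rw [walkStep, dif_pos hz, if_neg h]

theorem walkStep_of_eq_zero {z : ℕ × ℕ} (hz : z.1 < L) (h : Arrives ω c ⟨z.1, hz⟩ t)
    (hv : dotProduct v (encodingVector ω z.1 hz t) = 0) :
    walkStep ω c v t z = (z.1, z.2 + 1) := by
  rw [walkStep, dif_pos hz, if_pos h, if_pos hv]

theorem walkStep_of_ne_zero {z : ℕ × ℕ} (hz : z.1 < L) (h : Arrives ω c ⟨z.1, hz⟩ t)
    (hv : dotProduct v (encodingVector ω z.1 hz t) ≠ 0) :
    walkStep ω c v t z = (z.1 + 1, z.2) := by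
  rw [walkStep, dif_pos hz, if_pos h, if_neg hv]

theorem walkStep_of_le {z : ℕ × ℕ} (hz : L ≤ z.1) : walkStep ω c v t z = z := by
  rw [walkStep, dif_neg hz.not_gt]

/-- The possible steps of the walk. -/
theorem walkStep_cases (z : ℕ × ℕ) :
    walkStep ω c v t z = z ∨ walkStep ω c v t z = (z.1, z.2 + 1) ∨
      ∃ hz : z.1 < L, Arrives ω c ⟨z.1, hz⟩ t ∧
        dotProduct v (encodingVector ω z.1 hz t) ≠ 0 ∧ walkStep ω c v t z = (z.1 + 1, z.2) := by
  by_cases hz : z.1 < L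
  · by_cases h : Arrives ω c ⟨z.1, hz⟩ t
    · by_cases hv : dotProduct v (encodingVector ω z.1 hz t) = 0
      · exact .inr (.inl (walkStep_of_eq_zero hz h hv))
      · exact .inr (.inr ⟨hz, h, hv, walkStep_of_ne_zero hz h hv⟩)
    · exact .inl (walkStep_of_not_arrives hz h)
  · exact .inl (walkStep_of_le (not_lt.1 hz))

theorem fst_le_fst_walkStep (z : ℕ × ℕ) : z.1 ≤ (walkStep ω c v t z).1 := by
  rcases walkStep_cases (ω := ω) (c := c) (v := v) (t := t) z with h | h | ⟨_, _, _, h⟩ <;>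
    simp [h]

theorem snd_le_snd_walkStep (z : ℕ × ℕ) : z.2 ≤ (walkStep ω c v t z).2 := by
  rcases walkStep_cases (ω := ω) (c := c) (v := v) (t := t) z with h | h | ⟨_, _, _, h⟩ <;>
    simp [h]

theorem monotone_fst_walk : Monotone fun t => (walk ω c v t).1 :=
  monotone_nat_of_le_succ fun _ => fst_le_fst_walkStep _

theorem monotone_snd_walk : Monotone fun t => (walk ω c v t).2 :=
  monotone_nat_of_le_succ fun _ => snd_le_snd_walkStep _

theorem fst_walk_le : ∀ t, (walk ω c v t).1 ≤ L
  | 0 => Nat.zero_le L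
  | t + 1 => by
    rw [walk]
    rcases walkStep_cases (ω := ω) (c := c) (v := v) (t := t) (walk ω c v t) with
      h | h | ⟨hz, _, _, h⟩ <;> rw [h]
    · exact fst_walk_le t
    · exact fst_walk_le t
    · exact hz

/-- The node that the walk has reached has received a packet that is not orthogonal to `v`. -/
theorem exists_arrives_of_fst_walk_eq_succ : ∀ {t i : ℕ}, (walk ω c v t).1 = i + 1 →
    ∃ hi : i < L, ∃ s < t, Arrives ω c ⟨i, hi⟩ s ∧ dotProduct v (encodingVector ω i hi s) ≠ 0
  | 0, i, h => by simp [walk] at h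
  | t + 1, i, h => by
    have ih := exists_arrives_of_fst_walk_eq_succ (t := t) (i := i)
    rw [walk] at h
    rcases walkStep_cases (ω := ω) (c := c) (v := v) (t := t) (walk ω c v t) with
      h1 | h1 | ⟨hz, h2, h3, h1⟩
    · obtain ⟨hi, s, hs, h4⟩ := ih (by rw [← h, h1])
      exact ⟨hi, s, hs.trans t.lt_succ_self, h4⟩
    · obtain ⟨hi, s, hs, h4⟩ := ih (by rw [← h, h1])
      exact ⟨hi, s, hs.trans t.lt_succ_self, h4⟩
    · rw [h1] at h
      obtain rfl : (walk ω c v t).1 = i := Nat.succ_injective h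
      exact ⟨hz, t, t.lt_succ_self, h2, h3⟩

theorem chunkDecodable_of_forall_fst_walk_eq [NeZero L] {n : ℕ}
    (h : ∀ v : Fin α → ZMod 2, v ≠ 0 → (walk ω c v n).1 = L) : ChunkDecodable ω n c := by
  refine chunkDecodable_of_forall_dotProduct_ne_zero fun v hv => ?_
  obtain ⟨_, s, hs, ⟨h1, h2⟩, h3⟩ := exists_arrives_of_fst_walk_eq_succ (i := L - 1)
    ((h v hv).trans (Nat.sub_add_cancel NeZero.one_le).symm)
  exact ⟨s, hs, h1, h2, h3⟩

open Classical in
/-- While the walk stays at a node, every arrival over the link ahead is counted. -/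
theorem snd_walk_add_of_fst_eq {i : ℕ} (hi : i < L) (h0 : (walk ω c v t).1 = i) :
    ∀ {w : ℕ}, (walk ω c v (t + w)).1 = i →
      (walk ω c v (t + w)).2 = (walk ω c v t).2 +
        ∑ r ∈ Finset.range w, if Arrives ω c ⟨i, hi⟩ (t + r) then 1 else 0
  | 0, _ => by simp
  | w + 1, h => by
    -- The node index is monotone, so equal values at both ends pin it in between; an arrival not
    -- orthogonal to `v` would have moved it.
    have h1 : (walk ω c v (t + w)).1 = i := le_antisymm
      (h ▸ monotone_fst_walk (ω := ω) (c := c) (v := v) (Nat.le_succ (t + w)))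
      (h0 ▸ monotone_fst_walk (ω := ω) (c := c) (v := v) (Nat.le_add_right t w))
    have ih := snd_walk_add_of_fst_eq hi h0 h1
    have hz : (walk ω c v (t + w)).1 < L := h1 ▸ hi
    have hstep : walk ω c v (t + (w + 1)) = walkStep ω c v (t + w) (walk ω c v (t + w)) := rfl
    rw [Finset.sum_range_succ, ← add_assoc (walk ω c v t).2, ← ih]
    have hiff : Arrives ω c ⟨i, hi⟩ (t + w) ↔ Arrives ω c ⟨(walk ω c v (t + w)).1, hz⟩ (t + w) := by
      simp only [h1]
    by_cases ha : Arrives ω c ⟨i, hi⟩ (t + w)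
    · by_cases hv : dotProduct v (encodingVector ω (walk ω c v (t + w)).1 hz (t + w)) = 0
      · rw [hstep, walkStep_of_eq_zero hz (hiff.1 ha) hv, if_pos ha]
      · rw [hstep, walkStep_of_ne_zero hz (hiff.1 ha) hv] at h
        simp [h1] at h
    · rw [hstep, walkStep_of_not_arrives hz (mt hiff.2 ha), if_neg ha, add_zero]

open Classical in
/-- If at least `Δ` packets of the chunk arrive over every link in each of `W` consecutive windows of
length `w`, then the walk has met many packets unless it has advanced far. -/
theorem le_snd_walk_of_windows {w W : ℕ} {Δ : ℝ} (hΔ : 0 ≤ Δ)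
    (hG : ∀ i : Fin L, ∀ j < W, Δ ≤ ∑ r ∈ Finset.range w, if Arrives ω c i (j * w + r) then (1 : ℝ) else 0)
    (hL : (walk ω c v (W * w)).1 < L) :
    ((W : ℝ) - (walk ω c v (W * w)).1) * Δ ≤ (walk ω c v (W * w)).2 := by
  suffices ∀ j ≤ W, ((j : ℝ) - (walk ω c v (j * w)).1) * Δ ≤ (walk ω c v (j * w)).2 from
    this W le_rfl
  intro j
  induction j with
  | zero => intro _; simp [walk]
  | succ j ih =>
    intro hj
    have ih := ih (Nat.le_of_succ_le hj)
    have hjw : (j + 1) * w = j * w + w := Nat.succ_mul j w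
    have hmono := monotone_fst_walk (ω := ω) (c := c) (v := v)
      (Nat.mul_le_mul_right w (Nat.le_succ j))
    have hlt : (walk ω c v ((j + 1) * w)).1 < L := lt_of_le_of_lt
      (monotone_fst_walk (ω := ω) (c := c) (v := v) (Nat.mul_le_mul_right w hj)) hL
    -- Either the walk stays put during window `j` and counts all its arrivals, at least `Δ`, or it
    -- advances and the left side does not grow.
    rcases hmono.eq_or_lt with heq | hlt'
    · simp only [hjw] at heq hlt ⊢
      have hi : (walk ω c v (j * w)).1 < L := heq ▸ hlt
      have h1 := snd_walk_add_of_fst_eq hi rfl heq.symm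
      have h2 := hG ⟨_, hi⟩ j hj
      rw [h1, ← heq]
      push_cast
      linarith
    · have h1 : ((walk ω c v (j * w)).1 : ℝ) + 1 ≤ (walk ω c v ((j + 1) * w)).1 := by
        exact_mod_cast hlt'
      have h2 : ((walk ω c v (j * w)).2 : ℝ) ≤ (walk ω c v ((j + 1) * w)).2 := by
        exact_mod_cast monotone_snd_walk (ω := ω) (c := c) (v := v)
          (Nat.mul_le_mul_right w (Nat.le_succ j))
      refine le_trans ?_ (ih.trans h2)
      push_cast
      exact mul_le_mul_of_nonneg_right (by linarith) hΔ

end Walk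

theorem zmod_two_eq_one_of_ne_zero : ∀ {a : ZMod 2}, a ≠ 0 → a = 1 := by decide

/-! ### The supermartingale and its tail bound -/

section Supermartingale

variable {L q α : ℕ}

theorem finite_setOf_snd_lt (L n : ℕ) : {y : Fin L × ℕ | y.2 < n}.Finite :=
  (Set.finite_univ.prod (Set.finite_Iio n)).subset fun _ hy => ⟨trivial, hy⟩

theorem measurable_of_congr_of_time {β : Type*} [MeasurableSpace β] [Nonempty β]
    {f : Outcome L q α → β} (n : ℕ)
    (h : ∀ ω ω' : Outcome L q α, (∀ y : Fin L × ℕ, y.2 < n → ω y = ω' y) → f ω = f ω') :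
    Measurable f :=
  DependsOn.measurable_of_finite (finite_setOf_snd_lt L n) fun ω ω' => h ω ω'

theorem measurable_walk (c : Fin q) (v : Fin α → ZMod 2) (t : ℕ) :
    Measurable fun ω : Outcome L q α => walk ω c v t :=
  measurable_of_congr_of_time t fun _ _ => walk_congr

theorem encodingVector_zero_update {ω : Outcome L q α} {t : ℕ} (hi : 0 < L) (x : Slot q α t) :
    encodingVector (Function.update ω (⟨0, hi⟩, t) x) 0 hi t = x.2.2.1 := by
  simp [encodingVector, sourceCoeff]

-- The new slot enters only through its chunk and coefficients; the packets being combined come from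
-- earlier slots and are unaffected by it.
open Classical in
theorem encodingVector_succ_update {ω : Outcome L q α} {t i : ℕ} (hi : i + 1 < L)
    (x : Slot q α t) :
    encodingVector (Function.update ω (⟨i + 1, hi⟩, t) x) (i + 1) hi t =
      ∑ s : Fin t, if Arrives ω x.2.1 ⟨i, Nat.lt_of_succ_lt hi⟩ s then
        x.2.2.2 s • encodingVector ω i (Nat.lt_of_succ_lt hi) s else 0 := by
  have hne : ∀ y : Fin L × ℕ, y.2 < t → Function.update ω (⟨i + 1, hi⟩, t) x y = ω y := fun y hy =>
    Function.update_of_ne (fun h => hy.ne (congrArg Prod.snd h)) _ _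
  simp only [encodingVector]
  refine Finset.sum_congr rfl fun s _ => ?_
  have hs := hne (⟨i, Nat.lt_of_succ_lt hi⟩, (s : ℕ)) s.2
  rw [encodingVector_congr_of_time i _ s (fun y hy => hne y (hy.trans s.2)) hs]
  simp only [Arrives, Success, chunk, relayCoeff, hs, Function.update_self]
  congr

/-- If the node at the start of link `i` has received a packet that is not orthogonal to `v`, then
there is a measure preserving transformation of the next slot that flips the product of the encoding
vector with `v`. -/
theorem exists_measurePreserving_flip [NeZero q] {ω : Outcome L q α} {t : ℕ} {c : Fin q}
    {v : Fin α → ZMod 2} (hv : v ≠ 0) (p : unitInterval) :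
    ∀ {i : ℕ} (hi : i < L), (∀ i', i = i' + 1 → ∃ hi' : i' < L, ∃ s < t,
      Arrives ω c ⟨i', hi'⟩ s ∧ dotProduct v (encodingVector ω i' hi' s) ≠ 0) →
    ∃ σ : Slot q α t → Slot q α t, MeasurePreserving σ (slotLaw q α t p) (slotLaw q α t p) ∧
      ∀ x, (σ x).1 = x.1 ∧ (σ x).2.1 = x.2.1 ∧ (x.2.1 = c →
        dotProduct v (encodingVector (Function.update ω (⟨i, hi⟩, t) (σ x)) i hi t) =
          dotProduct v (encodingVector (Function.update ω (⟨i, hi⟩, t) x) i hi t) + 1)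
  | 0, hi, _ => by
    obtain ⟨j, hj⟩ := Function.ne_iff.1 hv
    rw [Pi.zero_apply] at hj
    -- Source: add 1 to a coefficient at which `v` is nonzero.
    refine ⟨_, measurePreserving_slotLaw_translate p (Pi.single j 1) 0, fun x =>
      ⟨rfl, rfl, fun _ => ?_⟩⟩
    rw [encodingVector_zero_update, encodingVector_zero_update, dotProduct_add,
      dotProduct_single_one, zmod_two_eq_one_of_ne_zero hj]
  | i + 1, hi, h => by
    obtain ⟨_, s, hs, ha, hne⟩ := h i rfl
    -- Interior node: add 1 to the coefficient of the received packet that is not orthogonal to `v`.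
    refine ⟨_, measurePreserving_slotLaw_translate p 0 (Pi.single ⟨s, hs⟩ 1), fun x =>
      ⟨rfl, rfl, fun hc => ?_⟩⟩
    have h1 : dotProduct v (encodingVector ω i (Nat.lt_of_succ_lt hi) s) = 1 :=
      zmod_two_eq_one_of_ne_zero hne
    rw [encodingVector_succ_update, encodingVector_succ_update, ← h1, ← dotProduct_add, hc]
    congr 1
    rw [← sub_eq_iff_eq_add', ← Finset.sum_sub_distrib, Finset.sum_eq_single ⟨s, hs⟩]
    · simp [ha, add_smul, h1]
    · intro r _ hr
      simp [hr]
    · simp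

/-- The weight of a position of the walk. -/
noncomputable def weight (a b : ENNReal) (z : ℕ × ℕ) : ENNReal := a ^ z.2 * b ^ z.1

/-- A slot `x` is paired with its flip `σ x`. If a packet of the chunk arrives, one of the two is
counted as a failure and the other advances the walk, so their weights add up to `a + b = 2` times
the old one; otherwise nothing moves. As `σ` preserves the law, averaging gives the bound. -/
theorem lintegral_weight_walkStep_update_le [NeZero q] {ω : Outcome L q α} {t : ℕ} {c : Fin q}
    {v : Fin α → ZMod 2} (hv : v ≠ 0) (p : unitInterval) {a b : ENNReal} (hab : a + b = 2)
    {i f : ℕ} (hi : i < L) (h : ∀ i', i = i' + 1 → ∃ hi' : i' < L, ∃ s < t,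
      Arrives ω c ⟨i', hi'⟩ s ∧ dotProduct v (encodingVector ω i' hi' s) ≠ 0) :
    ∫⁻ x, weight a b (walkStep (Function.update ω (⟨i, hi⟩, t) x) c v t (i, f)) ∂slotLaw q α t p ≤
      weight a b (i, f) := by
  obtain ⟨σ, hσ, hσx⟩ := exists_measurePreserving_flip hv p hi h
  set g : Slot q α t → ENNReal :=
    fun x => weight a b (walkStep (Function.update ω (⟨i, hi⟩, t) x) c v t (i, f)) with hg
  have hsum : ∀ x, g x + g (σ x) ≤ 2 * weight a b (i, f) := fun x => by
    obtain ⟨h1, h2, h3⟩ := hσx x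
    have harr : ∀ y : Slot q α t, Arrives (Function.update ω (⟨i, hi⟩, t) y) c ⟨i, hi⟩ t ↔
        (y.1 = true ∧ y.2.1 = c) := fun y => by
      simp [Arrives, Success, chunk]
    by_cases hx : x.1 = true ∧ x.2.1 = c
    · have hx' : (σ x).1 = true ∧ (σ x).2.1 = c := by rwa [h1, h2]
      have hw : weight a b (i, f + 1) + weight a b (i + 1, f) = 2 * weight a b (i, f) := by
        simp only [weight]
        rw [← hab]
        ring
      have h3 := h3 hx.2
      by_cases hz : dotProduct v
          (encodingVector (Function.update ω (⟨i, hi⟩, t) x) i hi t) = 0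
      · rw [hz, zero_add] at h3
        simp only [hg]
        rw [walkStep_of_eq_zero (z := (i, f)) hi ((harr x).2 hx) hz,
          walkStep_of_ne_zero (z := (i, f)) hi ((harr _).2 hx') (by rw [h3]; exact one_ne_zero)]
        exact hw.le
      · have h4 := zmod_two_eq_one_of_ne_zero hz
        rw [h4] at h3
        simp only [hg]
        rw [walkStep_of_ne_zero (z := (i, f)) hi ((harr x).2 hx) hz,
          walkStep_of_eq_zero (z := (i, f)) hi ((harr _).2 hx') (by rw [h3]; rfl), add_comm]
        exact hw.le
    · have hx' : ¬ ((σ x).1 = true ∧ (σ x).2.1 = c) := by rwa [h1, h2]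
      simp only [hg]
      rw [walkStep_of_not_arrives (z := (i, f)) hi (mt (harr x).1 hx),
        walkStep_of_not_arrives (z := (i, f)) hi (mt (harr _).1 hx'), two_mul]
  have h2 : 2 * ∫⁻ x, g x ∂slotLaw q α t p ≤ 2 * weight a b (i, f) := calc
    2 * ∫⁻ x, g x ∂slotLaw q α t p
        = ∫⁻ x, g x ∂slotLaw q α t p + ∫⁻ x, g (σ x) ∂slotLaw q α t p := by
          rw [hσ.lintegral_comp .of_discrete, two_mul]
    _ = ∫⁻ x, g x + g (σ x) ∂slotLaw q α t p := (lintegral_add_left .of_discrete _).symm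
    _ ≤ ∫⁻ _, 2 * weight a b (i, f) ∂slotLaw q α t p := lintegral_mono hsum
    _ = 2 * weight a b (i, f) := by simp
  exact (ENNReal.mul_le_mul_iff_right two_ne_zero ENNReal.ofNat_ne_top).1 h2

/-- The weight of the walk is a supermartingale. -/
theorem lintegral_weight_walk_le_one [NeZero q] (p : Fin L → unitInterval) (c : Fin q)
    {v : Fin α → ZMod 2} (hv : v ≠ 0) {a b : ENNReal} (hab : a + b = 2) (t : ℕ) :
    ∫⁻ ω, weight a b (walk ω c v t) ∂law L q α p ≤ 1 := by
  classical
  have : IsProbabilityMeasure (law L q α p) := by unfold law; infer_instance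
  induction t with
  | zero => simp [walk, weight]
  | succ t ih =>
    refine le_trans ?_ ih
    -- The slot that decides the step is the one on the link ahead of the walk, so the integral is
    -- split by position to make it a fixed coordinate.
    have hsplit : ∀ f : Outcome L q α → ENNReal, (Measurable f) →
        ∫⁻ ω, f ω ∂law L q α p = ∑ i ∈ Finset.range (L + 1),
          ∫⁻ ω, (if (walk ω c v t).1 = i then f ω else 0) ∂law L q α p := fun f hf => by
      rw [← lintegral_finsetSum]
      · congr 1
        ext ω
        rw [Finset.sum_ite_eq, if_pos (Finset.mem_range.2 (Nat.lt_succ_of_le (fst_walk_le t)))]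
      · exact fun i _ => Measurable.ite
          (measurable_fst.comp (measurable_walk c v t) (measurableSet_singleton i)) hf
          measurable_const
    have hm : ∀ t, Measurable fun ω : Outcome L q α => weight a b (walk ω c v t) := fun t =>
      (Measurable.of_discrete (f := weight a b)).comp (measurable_walk c v t)
    rw [hsplit _ (hm (t + 1)), hsplit _ (hm t)]
    refine Finset.sum_le_sum fun i _ => ?_
    by_cases hi : i < L
    · have hmi : Measurable fun ω : Outcome L q α =>
          if (walk ω c v t).1 = i then weight a b (walk ω c v (t + 1)) else 0 :=
        Measurable.ite (measurable_fst.comp (measurable_walk c v t) (measurableSet_singleton i))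
          (hm (t + 1)) measurable_const
      rw [law, lintegral_infinitePi_eq_lintegral_update _ ((⟨i, hi⟩, t) : Fin L × ℕ) hmi]
      refine lintegral_mono fun ω => ?_
      have hw : ∀ x, walk (Function.update ω ((⟨i, hi⟩, t) : Fin L × ℕ) x) c v t = walk ω c v t :=
        fun x => walk_congr fun y hy =>
          Function.update_of_ne (fun h => hy.ne (congrArg Prod.snd h)) _ _
      by_cases hωi : (walk ω c v t).1 = i
      · simp only [walk, hw, hωi, if_true]
        obtain ⟨f, hf⟩ : ∃ f, walk ω c v t = (i, f) := ⟨_, Prod.ext hωi rfl⟩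
        rw [hf]
        refine lintegral_weight_walkStep_update_le hv (p _) hab hi fun i' hi' => ?_
        exact exists_arrives_of_fst_walk_eq_succ (hωi.trans hi')
      · simp [hw, hωi]
    · refine lintegral_mono fun ω => ?_
      by_cases hωi : (walk ω c v t).1 = i
      · simp only [walk, hωi, if_true]
        rw [walkStep_of_le (by rw [hωi]; exact not_lt.1 hi)]
      · simp [hωi]

/-- The walk is unlikely to meet many packets of the chunk without reaching the sink. -/
theorem law_fst_walk_lt_le [NeZero q] (p : Fin L → unitInterval) (c : Fin q)
    {v : Fin α → ZMod 2} (hv : v ≠ 0) {b : ℝ} (hb0 : 0 < b) (hb1 : b ≤ 1) (m n : ℕ) :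
    law L q α p {ω | (walk ω c v n).1 < L ∧ m ≤ (walk ω c v n).2} ≤
      ENNReal.ofReal (((2 - b) ^ m * b ^ (L - 1))⁻¹) := by
  have hpos : 0 < (2 - b) ^ m * b ^ (L - 1) := by
    have : 0 < 2 - b := by linarith
    positivity
  set a' := ENNReal.ofReal (2 - b)
  set b' := ENNReal.ofReal b
  have hab : a' + b' = 2 := by
    rw [← ENNReal.ofReal_add (by linarith) hb0.le]
    simp
  have ha1 : 1 ≤ a' := ENNReal.one_le_ofReal.2 (by linarith)
  have hb1' : b' ≤ 1 := ENNReal.ofReal_le_one.2 hb1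
  have hm : Measurable fun ω : Outcome L q α => weight a' b' (walk ω c v n) :=
    (Measurable.of_discrete (f := weight a' b')).comp (measurable_walk c v n)
  -- Markov's inequality: on the event the weight is at least `a' ^ m * b' ^ (L - 1)`, since `1 ≤
  -- a'`, `b' ≤ 1` and the node reached is at most `L - 1`.
  have hmarkov := (mul_meas_ge_le_lintegral (μ := law L q α p) hm (a' ^ m * b' ^ (L - 1))).trans
    (lintegral_weight_walk_le_one p c hv hab n)
  have heq : a' ^ m * b' ^ (L - 1) = ENNReal.ofReal ((2 - b) ^ m * b ^ (L - 1)) := by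
    rw [ENNReal.ofReal_mul (pow_nonneg (by linarith) _), ENNReal.ofReal_pow (by linarith),
      ENNReal.ofReal_pow hb0.le]
  rw [ENNReal.ofReal_inv_of_pos hpos, ← heq, ENNReal.le_inv_iff_mul_le, mul_comm]
  refine le_trans (mul_le_mul_right (measure_mono fun ω hω => ?_) _) hmarkov
  exact mul_le_mul' (pow_le_pow_right₀ ha1 hω.2)
    (pow_le_pow_right_of_le_one' hb1' (Nat.le_sub_one_of_lt hω.1))

end Supermartingale

/-! ### Arrivals in windows and the failure probability of a chunk -/

section Windows

variable {L q α : ℕ} [NeZero q]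

open Classical in
/-- The moment generating function of the number of arrivals in a window. -/
theorem lintegral_prod_arrives_le (p : Fin L → unitInterval) (c : Fin q) (i : Fin L) {θ : ℝ}
    (hθ : 0 ≤ θ) (t w : ℕ) :
    ∫⁻ ω, ∏ r ∈ Finset.range w, (if Arrives ω c i (t + r) then ENNReal.ofReal θ else 1)
      ∂law L q α p ≤ ENNReal.ofReal (Real.exp (-(p i / q * (1 - θ)))) ^ w := by
  have : IsProbabilityMeasure (law L q α p) := by unfold law; infer_instance
  have hm : ∀ w, Measurable fun ω : Outcome L q α =>
      ∏ r ∈ Finset.range w, (if Arrives ω c i (t + r) then ENNReal.ofReal θ else 1) := fun w =>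
    measurable_of_congr_of_time (t + w) fun ω ω' h => Finset.prod_congr rfl fun r hr => by
      have := h (i, t + r) (Nat.add_lt_add_left (Finset.mem_range.1 hr) t)
      simp only [Arrives, Success, chunk, this]
      congr
  induction w with
  | zero => simp
  | succ w ih =>
    -- Resampling the last slot of the window splits off one independent factor.
    rw [law, lintegral_infinitePi_eq_lintegral_update _ ((i, t + w) : Fin L × ℕ) (hm (w + 1)),
      pow_succ]
    have hinner : ∀ ω : Outcome L q α, ∫⁻ x, ∏ r ∈ Finset.range (w + 1),
        (if Arrives (Function.update ω ((i, t + w) : Fin L × ℕ) x) c i (t + r) then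
          ENNReal.ofReal θ else 1) ∂slotLaw q α (t + w) (p i) ≤
        (∏ r ∈ Finset.range w, (if Arrives ω c i (t + r) then ENNReal.ofReal θ else 1)) *
          ENNReal.ofReal (Real.exp (-(p i / q * (1 - θ)))) := fun ω => by
      have h1 : ∀ x : Slot q α (t + w), ∏ r ∈ Finset.range (w + 1),
          (if Arrives (Function.update ω ((i, t + w) : Fin L × ℕ) x) c i (t + r) then
            ENNReal.ofReal θ else 1) =
          (∏ r ∈ Finset.range w, (if Arrives ω c i (t + r) then ENNReal.ofReal θ else 1)) *
            (if x.1 = true ∧ x.2.1 = c then ENNReal.ofReal θ else 1) := fun x => by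
        rw [Finset.prod_range_succ]
        congr 1
        · refine Finset.prod_congr rfl fun r hr => ?_
          have : ((i, t + r) : Fin L × ℕ) ≠ (i, t + w) := fun h => by
            have h1 : t + r = t + w := congrArg Prod.snd h
            have := Finset.mem_range.1 hr
            omega
          simp only [Arrives, Success, chunk, Function.update_of_ne this]
          congr
        · simp only [Arrives, Success, chunk, Function.update_self]
      simp_rw [h1]
      rw [lintegral_const_mul _ .of_discrete]
      gcongr
      exact lintegral_slotLaw_arrival_le (p i) c hθ
    refine (lintegral_mono hinner).trans ?_
    rw [lintegral_mul_const _ (hm w)]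
    gcongr
    exact ih

open Classical in
/-- A Chernoff bound for the number of arrivals in a window. -/
theorem law_sum_arrives_lt_le (p : Fin L → unitInterval) (c : Fin q) (i : Fin L) {Δ x : ℝ}
    (hΔ : 0 ≤ Δ) (hx0 : 0 < x) (hx1 : x ≤ 1) (t w : ℕ) (hw : (1 + x) * Δ ≤ w * (p i / q)) :
    law L q α p {ω | ∑ r ∈ Finset.range w, (if Arrives ω c i (t + r) then (1 : ℝ) else 0) < Δ} ≤
      ENNReal.ofReal (Real.exp (-(x ^ 2 * Δ / 8))) := by
  -- With this `θ`, `log θ ≥ -(x / 4 + x ^ 2 / 8)`; the exponent is then at most `Δ * (x / 4 + x ^ 2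
  -- / 8 - (1 + x) * x / 4) = -(x ^ 2 * Δ / 8)`.
  set θ : ℝ := 1 - x / 4 with hθdef
  have hθ : 0 < θ := by linarith
  have hθ1 : θ ≤ 1 := by linarith
  have hm : Measurable fun ω : Outcome L q α =>
      ∏ r ∈ Finset.range w, (if Arrives ω c i (t + r) then ENNReal.ofReal θ else 1) :=
    measurable_of_congr_of_time (t + w) fun ω ω' h => Finset.prod_congr rfl fun r hr => by
      have := h (i, t + r) (Nat.add_lt_add_left (Finset.mem_range.1 hr) t)
      simp only [Arrives, Success, chunk, this]
      congr
  have hmarkov := (mul_meas_ge_le_lintegral (μ := law L q α p) hm (ENNReal.ofReal (θ ^ Δ))).trans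
    (lintegral_prod_arrives_le p c i hθ.le t w)
  have hpos : 0 < θ ^ Δ := Real.rpow_pos_of_pos hθ _
  have hsub : {ω : Outcome L q α |
      ∑ r ∈ Finset.range w, (if Arrives ω c i (t + r) then (1 : ℝ) else 0) < Δ} ⊆
      {ω | ENNReal.ofReal (θ ^ Δ) ≤
        ∏ r ∈ Finset.range w, (if Arrives ω c i (t + r) then ENNReal.ofReal θ else 1)} := by
    intro ω hω
    have h1 : ∏ r ∈ Finset.range w, (if Arrives ω c i (t + r) then ENNReal.ofReal θ else 1) =
        ENNReal.ofReal
          (θ ^ (∑ r ∈ Finset.range w, (if Arrives ω c i (t + r) then (1 : ℝ) else 0))) := by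
      rw [Real.rpow_sum_of_pos hθ, ENNReal.ofReal_prod_of_nonneg
        fun r _ => (Real.rpow_pos_of_pos hθ _).le]
      refine Finset.prod_congr rfl fun r _ => ?_
      split_ifs <;> simp
    rw [Set.mem_ofPred_eq, h1]
    exact ENNReal.ofReal_le_ofReal (Real.rpow_le_rpow_of_exponent_ge hθ hθ1 (le_of_lt hω))
  have h2 : law L q α p {ω | ∑ r ∈ Finset.range w,
      (if Arrives ω c i (t + r) then (1 : ℝ) else 0) < Δ} * ENNReal.ofReal (θ ^ Δ) ≤
      ENNReal.ofReal (Real.exp (-(p i / q * (1 - θ)))) ^ w := by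
    rw [mul_comm]
    exact (mul_le_mul_right (measure_mono hsub) _).trans hmarkov
  rw [← ENNReal.le_div_iff_mul_le (.inl (by simpa using hpos)) (.inl ENNReal.ofReal_ne_top),
    ← ENNReal.ofReal_pow (Real.exp_pos _).le, ← ENNReal.ofReal_div_of_pos hpos] at h2
  refine h2.trans (ENNReal.ofReal_le_ofReal ?_)
  rw [← Real.exp_nat_mul, Real.rpow_def_of_pos hθ, ← Real.exp_sub, Real.exp_le_exp]
  have hlog : -(x / 4 + x ^ 2 / 8) ≤ Real.log θ := by
    refine le_trans ?_ (Real.one_sub_inv_le_log_of_pos hθ)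
    have h4 : θ⁻¹ ≤ 1 + (x / 4 + x ^ 2 / 8) := by
      rw [inv_le_iff_one_le_mul₀ hθ, hθdef]
      nlinarith [mul_nonneg (sq_nonneg x) (sub_nonneg.2 hx1)]
    linarith
  have h5 := mul_le_mul_of_nonneg_left hlog hΔ
  have h6 := mul_le_mul_of_nonneg_right hw (show 0 ≤ x / 4 by linarith)
  simp only [hθdef, sub_sub_cancel] at h5 ⊢
  nlinarith

/-- A bound for the probability that a chunk is not decodable. -/
theorem law_not_chunkDecodable_le [NeZero L] (p : Fin L → unitInterval) (c : Fin q)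
    {Δ x b : ℝ} {w W m : ℕ} (hΔ : 0 ≤ Δ) (hx0 : 0 < x) (hx1 : x ≤ 1) (hb0 : 0 < b) (hb1 : b ≤ 1)
    (hw : ∀ i, (1 + x) * Δ ≤ w * (p i / q)) (hm : (m : ℝ) ≤ ((W : ℝ) - L + 1) * Δ) :
    law L q α p {ω | ¬ ChunkDecodable ω (W * w) c} ≤ ENNReal.ofReal
      (L * W * Real.exp (-(x ^ 2 * Δ / 8)) + 2 ^ α * ((2 - b) ^ m * b ^ (L - 1))⁻¹) := by
  classical
  set V : Finset (Fin α → ZMod 2) := Finset.univ.erase 0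
  have hsub : {ω : Outcome L q α | ¬ ChunkDecodable ω (W * w) c} ⊆
      (⋃ z ∈ (Finset.univ : Finset (Fin L)) ×ˢ Finset.range W, {ω |
        ∑ r ∈ Finset.range w, (if Arrives ω c z.1 (z.2 * w + r) then (1 : ℝ) else 0) < Δ}) ∪
      ⋃ v ∈ V, {ω | (walk ω c v (W * w)).1 < L ∧ m ≤ (walk ω c v (W * w)).2} := by
    intro ω hω
    by_contra hnot
    simp only [Set.mem_union, Set.mem_iUnion, Set.mem_ofPred_eq, not_or, not_exists, not_and,
      not_lt, not_le, Finset.mem_product, Finset.mem_univ, true_and, Finset.mem_range,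
      exists_prop, Prod.forall, V, Finset.mem_erase, and_true] at hnot
    obtain ⟨h1, h2⟩ := hnot
    refine hω (chunkDecodable_of_forall_fst_walk_eq fun v hv => ?_)
    -- A walk short of the sink is at node `L - 1` at most, so it has counted at least `(W - L + 1)
    -- * Δ ≥ m` failures.
    refine (fst_walk_le _).antisymm (not_lt.1 fun hlt => ?_)
    have h3 := le_snd_walk_of_windows hΔ h1 hlt
    have h4 : ((walk ω c v (W * w)).1 : ℝ) + 1 ≤ L := by exact_mod_cast hlt
    have h5 : ((walk ω c v (W * w)).2 : ℝ) < m := by exact_mod_cast h2 v hv hlt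
    have h6 : ((W : ℝ) - L + 1) * Δ ≤ ((W : ℝ) - (walk ω c v (W * w)).1) * Δ :=
      mul_le_mul_of_nonneg_right (by linarith) hΔ
    linarith
  have hE : 0 ≤ Real.exp (-(x ^ 2 * Δ / 8)) := (Real.exp_pos _).le
  have hR : 0 ≤ ((2 - b) ^ m * b ^ (L - 1))⁻¹ := by
    have : 0 < 2 - b := by linarith
    positivity
  refine (measure_mono hsub).trans ((measure_union_le _ _).trans ?_)
  rw [ENNReal.ofReal_add (by positivity) (by positivity)]
  refine add_le_add ?_ ?_
  · refine (measure_biUnion_finset_le _ _).trans ((Finset.sum_le_card_nsmul _ _ _ fun z _ =>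
      law_sum_arrives_lt_le p c z.1 hΔ hx0 hx1 (z.2 * w) w (hw z.1)).trans_eq ?_)
    rw [nsmul_eq_mul, ENNReal.ofReal_mul (by positivity), ENNReal.ofReal_mul (by positivity)]
    simp
  · refine (measure_biUnion_finset_le _ _).trans ((Finset.sum_le_card_nsmul _ _ _ fun v hv =>
      law_fst_walk_lt_le p c (Finset.ne_of_mem_erase hv) hb0 hb1 m (W * w)).trans ?_)
    rw [nsmul_eq_mul, ENNReal.ofReal_mul (by positivity)]
    gcongr
    have : V.card ≤ 2 ^ α := by
      refine (Finset.card_le_univ V).trans_eq ?_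
      simp [ZMod.card]
    calc (V.card : ENNReal) ≤ ((2 ^ α : ℕ) : ENNReal) := by exact_mod_cast this
      _ = ENNReal.ofReal (2 ^ α) := by
        rw [← ENNReal.ofReal_natCast]; push_cast; rfl

end Windows

/-! ### Concentration of the number of undecodable chunks -/

section Concentration

variable {L q α : ℕ} [NeZero L]

open Classical in
/-- The number of chunks that the sink cannot decode after `n` instants. -/
noncomputable def undecodableCount (ω : Outcome L q α) (n : ℕ) : ℕ :=
  (Finset.univ.filter fun c : Fin q => ¬ ChunkDecodable ω n c).card

/-- Only the old and the new chunk of the changed slot can change their status. -/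
theorem undecodableCount_update_le (ω : Outcome L q α) (n : ℕ) (j : Fin L × ℕ)
    (x : Slot q α j.2) :
    undecodableCount (Function.update ω j x) n ≤ undecodableCount ω n + 2 := by
  classical
  have hsub : (Finset.univ.filter fun c : Fin q => ¬ ChunkDecodable (Function.update ω j x) n c) ⊆
      (Finset.univ.filter fun c : Fin q => ¬ ChunkDecodable ω n c) ∪ {(ω j).2.1, x.2.1} := by
    intro c hc
    simp only [Finset.mem_filter, Finset.mem_univ, true_and, Finset.mem_union, Finset.mem_insert,
      Finset.mem_singleton] at hc ⊢
    by_contra! hnot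
    refine hc (hnot.1.congr_of_chunk fun y => ?_)
    by_cases hy : y = j
    · subst hy
      exact .inr ⟨hnot.2.1.symm, by simpa using hnot.2.2.symm⟩
    · exact .inl (Function.update_of_ne hy _ _).symm
  refine (Finset.card_le_card hsub).trans ((Finset.card_union_le _ _).trans ?_)
  exact Nat.add_le_add_left Finset.card_le_two _

theorem abs_undecodableCount_update_sub_le (ω : Outcome L q α) (n : ℕ) (j : Fin L × ℕ)
    (x : Slot q α j.2) :
    |(undecodableCount (Function.update ω j x) n : ℝ) - undecodableCount ω n| ≤ 2 := by
  have h1 : (undecodableCount (Function.update ω j x) n : ℝ) ≤ undecodableCount ω n + 2 := by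
    exact_mod_cast undecodableCount_update_le ω n j x
  have h2 : (undecodableCount ω n : ℝ) ≤ undecodableCount (Function.update ω j x) n + 2 := by
    have := undecodableCount_update_le (Function.update ω j x) n j (ω j)
    rw [Function.update_idem, Function.update_eq_self] at this
    exact_mod_cast this
  rw [abs_le]
  constructor <;> linarith

/-- The number of undecodable chunks is concentrated. -/
theorem law_lt_undecodableCount_le [NeZero q] (p : Fin L → unitInterval) {n : ℕ} {β γ : ℝ} (hβ : 0 ≤ β)
    (hγ : 0 ≤ γ)
    (h : ∀ c : Fin q, law L q α p {ω | ¬ ChunkDecodable ω n c} ≤ ENNReal.ofReal β) :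
    law L q α p {ω | (1 + γ) * β * q < undecodableCount ω n} ≤
      ENNReal.ofReal (Real.exp (-(γ * β * q) ^ 2 / (8 * (L * n)))) := by
  classical
  have : IsProbabilityMeasure (law L q α p) := by unfold law; infer_instance
  have hdec : ∀ c : Fin q, Measurable fun ω : Outcome L q α => ChunkDecodable ω n c := fun c =>
    measurable_of_congr_of_time n fun ω ω' hω =>
      propext ⟨.congr_of_time hω, .congr_of_time fun y hy => (hω y hy).symm⟩
  have hcongr : ∀ ω ω' : Outcome L q α, (∀ y : Fin L × ℕ, y.2 < n → ω y = ω' y) →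
      (undecodableCount ω n : ℝ) = undecodableCount ω' n := fun ω ω' hω => by
    have h1 : ∀ c, ChunkDecodable ω n c ↔ ChunkDecodable ω' n c := fun c =>
      ⟨.congr_of_time hω, .congr_of_time fun y hy => (hω y hy).symm⟩
    simp only [undecodableCount, h1]
  have hm : Measurable fun ω : Outcome L q α => (undecodableCount ω n : ℝ) :=
    measurable_of_congr_of_time n hcongr
  have hB : ∀ ω : Outcome L q α, |(undecodableCount ω n : ℝ)| ≤ q := fun ω => by
    rw [Nat.abs_cast]
    exact_mod_cast (Finset.card_le_univ _).trans_eq (Fintype.card_fin q)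
  have hE : ∫ ω, (undecodableCount ω n : ℝ) ∂law L q α p ≤ β * q := by
    have h1 : ∀ ω : Outcome L q α, (undecodableCount ω n : ℝ) =
        ∑ c : Fin q, {ω | ¬ ChunkDecodable ω n c}.indicator (fun _ => (1 : ℝ)) ω := fun ω => by
      rw [undecodableCount, Finset.card_filter]
      push_cast
      exact Finset.sum_congr rfl fun c _ => by simp [Set.indicator_apply]
    have hms : ∀ c : Fin q, MeasurableSet {ω : Outcome L q α | ¬ ChunkDecodable ω n c} :=
      fun c => (measurableSet_setOfPred.2 (hdec c)).compl
    simp_rw [h1]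
    rw [integral_finsetSum _ fun c _ => (integrable_const (1 : ℝ)).indicator (hms c)]
    calc ∑ c : Fin q, ∫ ω, {ω | ¬ ChunkDecodable ω n c}.indicator (fun _ => (1 : ℝ)) ω
          ∂law L q α p ≤ ∑ _c : Fin q, β := Finset.sum_le_sum fun c _ => by
            rw [integral_indicator_const _ (hms c), smul_eq_mul, mul_one]
            exact ENNReal.toReal_le_of_le_ofReal hβ (h c)
      _ = β * q := by simp [mul_comm]
  have hdep : DependsOn (fun ω : Outcome L q α => (undecodableCount ω n : ℝ))
      ((Finset.univ ×ˢ Finset.range n : Finset (Fin L × ℕ)) : Set (Fin L × ℕ)) :=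
    fun ω ω' hω => hcongr ω ω' fun y hy => hω y (by simpa using hy)
  -- There are `L * n` relevant slots with differences at most 2, whence `2 * (L * n * 2 ^ 2)` in
  -- the denominator.
  have hmain := measureReal_ge_le_of_abs_update_sub_le
    (fun y : Fin L × ℕ => slotLaw q α y.2 (p y.1)) hm hB hdep
    (fun ω j x => abs_undecodableCount_update_sub_le ω n j x)
    (u := γ * β * q) (by positivity)
  rw [← ENNReal.ofReal_toReal (measure_ne_top (law L q α p) _)]
  refine ENNReal.ofReal_le_ofReal ((measureReal_mono (μ := law L q α p) fun ω hω => ?_).trans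
    (hmain.trans_eq ?_))
  · have h2 : (1 + γ) * β * q < undecodableCount ω n := hω
    change γ * β * q ≤ undecodableCount ω n - ∫ ω, (undecodableCount ω n : ℝ) ∂law L q α p
    linarith
  · simp only [Finset.card_product, Finset.card_univ, Fintype.card_fin, Finset.card_range]
    push_cast
    ring_nf

/-- If few chunks are undecodable, then the message is recoverable. -/
theorem codingDelay_le_of_undecodableCount_le {k : ℕ} {F : Type*} {E : Precode k q α F} {δ : ℝ}
    (hE : E.CorrectsErasures δ) {ω : Outcome L q α} {n : ℕ}
    (h : (undecodableCount ω n : ℝ) ≤ δ * q) : codingDelay E ω ≤ n := by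
  classical
  refine iInf₂_le n ?_
  set R : Finset (Fin q × Fin α) := Finset.univ.filter fun j => ChunkDecodable ω n j.1
  -- Each undecodable chunk erases exactly its `α` packets, so the erased fraction of packets is
  -- that of the chunks.
  have hR : Rᶜ = (Finset.univ.filter fun c : Fin q => ¬ ChunkDecodable ω n c) ×ˢ Finset.univ := by
    ext j
    simp [R]
  have hinj := hE R (by
    rw [hR, Finset.card_product, Finset.card_univ, Fintype.card_fin]
    push_cast
    rw [← mul_assoc]
    exact mul_le_mul_of_nonneg_right h (Nat.cast_nonneg α))
  intro x y hxy
  refine hinj (funext fun j => ?_)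
  exact congrFun hxy ⟨j.1, (Finset.mem_filter.1 j.2).2⟩

end Concentration

/-! ### Choice of the constants -/

/-- Bounds the loss from using `2 - b` instead of `2` against the union bound over `2 ^ α` vectors;
it is small beside the surplus of `m` over `α`. -/
theorem log_two_sub_le {b : ℝ} (hb0 : 0 < b) (hb1 : b ≤ 1) :
    Real.log 2 - b ≤ Real.log (2 - b) := by
  have h1 : (2 : ℝ) - b = 2 * (1 - b / 2) := by ring
  have hpos : 0 < 1 - b / 2 := by linarith
  rw [h1, Real.log_mul two_ne_zero hpos.ne']
  have h2 := Real.one_sub_inv_le_log_of_pos hpos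
  have h3 : (1 - b / 2)⁻¹ ≤ 1 + b := by
    rw [inv_le_iff_one_le_mul₀ hpos]
    nlinarith
  linarith

/-- The failure probability of the random linear combinations. -/
theorem two_pow_mul_inv_le {L γb γc ℓ α : ℝ} {l a m : ℕ} (hL : 1 ≤ L) (hl : (l : ℝ) ≤ L)
    (hγc : 0 < γc) (hγc1 : γc ≤ 1) (hγb : 0 < γb) (ha : (a : ℝ) = α)
    (hℓ : Real.log 2 ≤ ℓ) (hℓb : Real.log (1 / γb) ≤ ℓ) (hℓc : Real.log (1 / γc) ≤ ℓ)
    (hα : 100 * (L * ℓ) ≤ γc * α) (hm : (1 + γc / 4) * α ≤ m) :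
    2 ^ a * ((2 - γc / 16) ^ m * (γc / 16) ^ l)⁻¹ ≤ γb / 2 := by
  have hlog2 := Real.log_two_gt_d9
  have hb : 0 < γc / 16 := by positivity
  have h2b : 0 < 2 - γc / 16 := by linarith
  have hα0 : 0 ≤ α := ha ▸ Nat.cast_nonneg a
  have hpos : 0 < (2 : ℝ) ^ a * ((2 - γc / 16) ^ m * (γc / 16) ^ l)⁻¹ := by positivity
  rw [← Real.log_le_log_iff hpos (by positivity), Real.log_mul (by positivity) (by positivity),
    Real.log_inv, Real.log_mul (by positivity) (by positivity), Real.log_pow, Real.log_pow,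
    Real.log_pow, Real.log_div hγb.ne' two_ne_zero, ha]
  rw [one_div, Real.log_inv] at hℓb hℓc
  have h1 := log_two_sub_le hb (by linarith)
  have h16 : Real.log (γc / 16) = Real.log γc - 4 * Real.log 2 := by
    rw [Real.log_div hγc.ne' (by norm_num), show (16 : ℝ) = 2 ^ 4 by norm_num, Real.log_pow]
    norm_num
  -- After taking logarithms, the surplus `γc / 4` outweighs the loss `γc / 16` and leaves a gain of
  -- about `0.09 * γc * α ≥ 9 * L * ℓ`; the remaining terms cost at most `7 * L * ℓ`.
  have h2 : (1 + γc / 4) * α * (Real.log 2 - γc / 16) ≤ m * Real.log (2 - γc / 16) :=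
    mul_le_mul hm h1 (by linarith) (Nat.cast_nonneg m)
  have h3 : -(5 * (L * ℓ)) ≤ l * Real.log (γc / 16) := by
    rw [h16]
    have h4 : 0 ≤ 5 * ℓ + (Real.log γc - 4 * Real.log 2) := by linarith
    have h5 : 0 ≤ (l : ℝ) := Nat.cast_nonneg l
    nlinarith [mul_nonneg h5 h4, mul_nonneg (sub_nonneg.2 hl) (show 0 ≤ 5 * ℓ by linarith)]
  have h4 : ℓ ≤ L * ℓ := le_mul_of_one_le_left (by linarith) hL
  have h5 : γc * γc * α ≤ γc * α :=
    mul_le_mul_of_nonneg_right (mul_le_of_le_one_left hγc.le hγc1) hα0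
  have h6 : 0.6931 * (γc * α) ≤ Real.log 2 * (γc * α) :=
    mul_le_mul_of_nonneg_right (by linarith) (by positivity)
  nlinarith

/-- The failure probability of the traffic. -/
theorem mul_exp_le_half {L W γb γc E : ℝ} (hL : 1 ≤ L) (hγc : 0 < γc) (hγc1 : γc ≤ 1) (hγb : 0 < γb)
    (hγb1 : γb ≤ 1) (hW : W ≤ 21 * L / γc) (hℓ : Real.log 2 ≤ Real.log (L / (γb * γc)))
    (hE : 10 * Real.log (L / (γb * γc)) ≤ E) :
    L * W * Real.exp (-E) ≤ γb / 2 := by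
  set u : ℝ := γb * γc / L with hu
  have hL0 : 0 < L := by linarith
  have hu0 : 0 < u := by positivity
  have huinv : L / (γb * γc) = u⁻¹ := by rw [hu, inv_div]
  rw [huinv] at hℓ hE
  have hu2 : u ≤ 1 / 2 := by
    have := (Real.log_le_log_iff two_pos (inv_pos.2 hu0)).1 hℓ
    rw [one_div]
    exact (le_inv_comm₀ two_pos hu0).1 this
  -- Of these ten factors `u`, two absorb `L * W ≤ 21 * L ^ 2 / γc` and leave `γb`; the other eight
  -- give `21 / 2 ^ 8 < 1 / 2`.
  have hexp : Real.exp (-E) ≤ u ^ 10 := by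
    rw [← Real.exp_log (pow_pos hu0 10), Real.exp_le_exp, Real.log_pow]
    rw [Real.log_inv] at hE
    push_cast
    linarith
  have h8 : u ^ 8 ≤ (1 / 2) ^ 8 := pow_le_pow_left₀ hu0.le hu2 8
  have h1 : L / γc * u = γb := by rw [hu]; field_simp
  have h2 : L * u ≤ 1 := by
    rw [hu, mul_div_cancel₀ _ hL0.ne']
    exact mul_le_one₀ hγb1 hγc.le hγc1
  calc L * W * Real.exp (-E) ≤ L * (21 * L / γc) * u ^ 10 := by gcongr
    _ = 21 * (L / γc * u) * (L * u) * u ^ 8 := by ring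
    _ = 21 * γb * (L * u) * u ^ 8 := by rw [h1]
    _ ≤ 21 * γb * 1 * (1 / 2) ^ 8 := by gcongr
    _ ≤ γb / 2 := by linarith

/-- There are a number `W` of windows and a speed such that every chunk is decodable
with probability at least `1 - γb`. -/
theorem exists_windows_law_not_chunkDecodable_le (L : ℕ) [NeZero L] {γb γc : ℝ} (hγb : 0 < γb)
    (hγb1 : γb < 1) (hγc : 0 < γc) (hγc1 : γc < 1) :
    ∃ (W : ℕ) (B : ℝ), 0 < W ∧ 0 < B ∧ B < (1 + γc) * (1 + 100 * γb ^ 2) ∧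
      ∀ (q α w : ℕ) [NeZero q] (p : Fin L → unitInterval) (c : Fin q),
        30000 * ((L : ℝ) / γc ^ 3 * Real.log ((L : ℝ) / (γb * γc))) ≤ α →
        (∀ i, B * α / W ≤ w * (p i / q)) →
        law L q α p {ω | ¬ ChunkDecodable ω (W * w) c} ≤ ENNReal.ofReal γb := by
  have hL : (1 : ℝ) ≤ L := by exact_mod_cast NeZero.one_le
  have hL0 : (0 : ℝ) < L := by linarith
  set ℓ := Real.log ((L : ℝ) / (γb * γc)) with hℓdef
  have hbc : 0 < γb * γc := mul_pos hγb hγc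
  by_cases hℓ : Real.log 2 ≤ ℓ
  · have hℓ0 : 0 < ℓ := (Real.log_pos one_lt_two).trans_le hℓ
    have hlog2 := Real.log_two_gt_d9
    -- With this many windows, the at most `L` windows in which a walk advances are a fraction `γc /
    -- 20` of all.
    have hW0 : 0 < ⌈20 * L / γc⌉₊ := Nat.ceil_pos.2 (by positivity)
    have hWl : 20 * L / γc ≤ (⌈20 * L / γc⌉₊ : ℝ) := Nat.le_ceil _
    have hWu : (⌈20 * L / γc⌉₊ : ℝ) ≤ 21 * L / γc := by
      have h1 := (Nat.ceil_lt_add_one (show 0 ≤ 20 * (L : ℝ) / γc by positivity)).le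
      have h2 : 1 ≤ L / γc := by rw [one_le_div hγc]; linarith
      have h3 : 21 * L / γc = 20 * L / γc + L / γc := by ring
      linarith
    generalize ⌈20 * L / γc⌉₊ = W at hW0 hWl hWu
    have hW0' : (0 : ℝ) < W := by exact_mod_cast hW0
    refine ⟨W, 1 + γc, hW0, by linarith, ?_, fun q α w _ p c hα hw => ?_⟩
    · have : 0 < (1 + γc) * γb ^ 2 := by positivity
      linarith
    -- About `(1 + γc) * α` arrivals are expected over each link in all, hence `(1 + γc) * α / W`
    -- per window; the factor `1 + γc / 4` is the Chernoff slack.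
    set Δ : ℝ := (1 + γc) * α / ((1 + γc / 4) * W) with hΔ
    have hα3 : 30000 * (L * ℓ) ≤ γc ^ 3 * α := by
      have h1 := mul_le_mul_of_nonneg_left hα (show 0 ≤ γc ^ 3 by positivity)
      have h2 : γc ^ 3 * (30000 * ((L : ℝ) / γc ^ 3 * ℓ)) = 30000 * (L * ℓ) := by
        field_simp
      linarith
    have hα0 : (0 : ℝ) ≤ α := Nat.cast_nonneg α
    have hLℓ : 0 < L * ℓ := by positivity
    have hα1 : 30000 * (L * ℓ) ≤ γc * α := by
      refine hα3.trans (mul_le_mul_of_nonneg_right ?_ hα0)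
      exact pow_le_of_le_one hγc.le hγc1.le three_ne_zero
    have hΔl : (1 + γc / 2) * (α / W) ≤ Δ := by
      rw [hΔ, mul_div_mul_comm]
      refine mul_le_mul_of_nonneg_right ?_ (by positivity)
      rw [le_div_iff₀ (by positivity)]
      nlinarith
    have hm : ((⌈(1 + γc / 4) * (α : ℝ)⌉₊ : ℕ) : ℝ) ≤ ((W : ℝ) - L + 1) * Δ := by
      have h1 := (Nat.ceil_lt_add_one (show 0 ≤ (1 + γc / 4) * (α : ℝ) by positivity)).le
      have h2 : L ≤ γc / 20 * W := by
        rw [div_le_iff₀ hγc] at hWl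
        linarith
      have h3 : (1 - γc / 20) * W ≤ (W : ℝ) - L + 1 := by linarith
      have h4 : (1 - γc / 20) * W * ((1 + γc / 2) * (α / W)) ≤ ((W : ℝ) - L + 1) * Δ :=
        mul_le_mul h3 hΔl (by positivity) (le_trans (mul_nonneg (by linarith) hW0'.le) h3)
      -- This product exceeds `(1 + γc / 4) * α` by a multiple of `γc * α`, which absorbs the 1 lost
      -- in the ceiling.
      have h5 : (1 - γc / 20) * W * ((1 + γc / 2) * (α / W)) =
          (1 - γc / 20) * (1 + γc / 2) * α := by
        field_simp
      have h6 : ℓ ≤ L * ℓ := le_mul_of_one_le_left hℓ0.le hL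
      have h7 : γc * γc * α ≤ γc * α :=
        mul_le_mul_of_nonneg_right (mul_le_of_le_one_left hγc.le hγc1.le) hα0
      nlinarith
    have hx : ∀ i, (1 + γc / 4) * Δ ≤ w * (p i / q) := fun i => by
      refine le_of_eq_of_le ?_ (hw i)
      rw [hΔ]
      field_simp
    have hmain := law_not_chunkDecodable_le (α := α) p c (b := γc / 16) (by positivity)
      (by positivity) (by linarith) (by positivity) (by linarith) hx hm
    refine hmain.trans (ENNReal.ofReal_le_ofReal ?_)
    have hT : L * W * Real.exp (-((γc / 4) ^ 2 * Δ / 8)) ≤ γb / 2 := by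
      refine mul_exp_le_half hL hγc hγc1.le hγb hγb1.le hWu hℓ ?_
      have h1 : (α : ℝ) / W ≤ Δ := by
        refine le_trans ?_ hΔl
        exact le_mul_of_one_le_left (by positivity) (by linarith)
      have h2 : γc * α / (21 * L) ≤ α / W := by
        rw [div_le_div_iff₀ (by positivity) hW0']
        rw [le_div_iff₀ hγc] at hWu
        nlinarith
      have h3 : 30000 * ℓ / 21 ≤ γc ^ 2 * (γc * α / (21 * L)) := by
        have : γc ^ 2 * (γc * α / (21 * L)) = γc ^ 3 * α / (21 * L) := by ring
        rw [this, div_le_div_iff₀ (by norm_num) (by positivity)]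
        nlinarith
      have h4 : γc ^ 2 * (γc * α / (21 * L)) ≤ γc ^ 2 * Δ := by
        gcongr
        exact h2.trans h1
      change 10 * ℓ ≤ _
      linarith
    have hR : (2 : ℝ) ^ α * ((2 - γc / 16) ^ ⌈(1 + γc / 4) * (α : ℝ)⌉₊ *
        (γc / 16) ^ (L - 1))⁻¹ ≤ γb / 2 := by
      refine two_pow_mul_inv_le (L := L) hL (by exact_mod_cast Nat.sub_le L 1) hγc hγc1.le hγb rfl hℓ
        ?_ ?_ ?_ (Nat.le_ceil _)
      · refine Real.log_le_log (by positivity) ?_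
        rw [div_le_div_iff₀ hγb hbc]
        nlinarith
      · refine Real.log_le_log (by positivity) ?_
        rw [div_le_div_iff₀ hγc hbc]
        nlinarith
      · linarith
    linarith
  -- Here the logarithm may be close to 0 and the assumption on `α` yields only `1 ≤ α`. But then `L
  -- = 1` and `γb`, `γc` exceed `1 / 2`, so the `100 * γb ^ 2` term leaves room for the crude speed
  -- `B = 16` with one window, and a failure probability below `0.37 + 0.1 < γb`.
  · push Not at hℓ
    have h1 : (L : ℝ) / (γb * γc) < 2 :=
      (Real.log_lt_log_iff (by positivity) two_pos).1 hℓ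
    rw [div_lt_iff₀ hbc] at h1
    have hbc1 : γb * γc < 1 := mul_lt_one_of_nonneg_of_lt_one_left hγb.le hγb1 hγc1.le
    have hγb2 : 1 / 2 < γb := by nlinarith
    have hγc2 : 1 / 2 < γc := by nlinarith
    have hL1 : L = 1 := by
      have : (L : ℝ) < 2 := by linarith
      have : L < 2 := by exact_mod_cast this
      have := NeZero.pos L
      omega
    have hℓ0 : 0 < ℓ := Real.log_pos (by rw [one_lt_div hbc]; linarith)
    refine ⟨1, 16, one_pos, by norm_num, by nlinarith, fun q α w _ p c hα hw => ?_⟩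
    have hα1 : 1 ≤ α := by
      have : (0 : ℝ) < α := lt_of_lt_of_le (by positivity) hα
      exact_mod_cast this
    have hα1' : (1 : ℝ) ≤ α := by exact_mod_cast hα1
    have hmain := law_not_chunkDecodable_le (α := α) p c (Δ := 8 * α) (x := 1) (b := 1 / 2) (w := w) (W := 1)
      (m := 8 * α) (by positivity) one_pos le_rfl (by norm_num) (by norm_num)
      (fun i => le_trans (by norm_num; linarith) (hw i)) (by rw [hL1]; push_cast; linarith)
    refine hmain.trans (ENNReal.ofReal_le_ofReal ?_)
    have hexp : Real.exp (-(1 ^ 2 * (8 * α) / 8)) ≤ 0.37 := by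
      have h2 : Real.exp (-(1 ^ 2 * (8 * (α : ℝ)) / 8)) ≤ Real.exp (-1) :=
        Real.exp_le_exp.2 (by linarith)
      have := Real.exp_neg_one_lt_d9
      linarith
    have hpow : (2 : ℝ) ^ α * ((2 - 1 / 2) ^ (8 * α) * (1 / 2) ^ (1 - 1))⁻¹ ≤ 0.1 := by
      have h2 : (2 : ℝ) ^ α * ((2 - 1 / 2) ^ (8 * α) * (1 / 2) ^ (1 - 1))⁻¹ =
          (2 * ((3 / 2) ^ 8)⁻¹) ^ α := by
        rw [mul_pow, pow_mul, inv_pow]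
        norm_num
      rw [h2]
      refine (pow_le_of_le_one (by positivity) (by norm_num) (by omega)).trans (by norm_num)
    subst hL1
    push_cast
    linarith

/-- A delay beyond `T ≥ n` means more than `(1 + γa) * γb * q` undecodable chunks at time `n`, where
`γb * q` bounds the mean and `γa` is the relative deviation. -/
theorem law_lt_codingDelay_le {L q α k : ℕ} [NeZero L] [NeZero q] {F : Type*}
    (p : Fin L → unitInterval) {E : Precode k q α F} {γa γb T ε : ℝ} {n : ℕ}
    (hγa : 0 ≤ γa) (hγb : 0 ≤ γb) (hε : 0 < ε) (hE : E.CorrectsErasures ((1 + γa) * γb))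
    (hdec : ∀ c : Fin q, law L q α p {ω | ¬ ChunkDecodable ω n c} ≤ ENNReal.ofReal γb)
    (hn : n ≤ T) (hdev : Real.log (1 / ε) ≤ (γa * γb * q) ^ 2 / (8 * (L * n))) :
    law L q α p {ω | ENNReal.ofReal T < (codingDelay E ω : ENNReal)} ≤ ENNReal.ofReal ε := by
  have hsub : {ω : Outcome L q α | ENNReal.ofReal T < (codingDelay E ω : ENNReal)} ⊆
      {ω | (1 + γa) * γb * q < undecodableCount ω n} := by
    intro ω hω
    by_contra hnot
    have h1 : codingDelay E ω ≤ n := codingDelay_le_of_undecodableCount_le hE (not_lt.1 hnot)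
    have h2 : (codingDelay E ω : ENNReal) ≤ ((n : ℕ∞) : ENNReal) := ENat.toENNReal_le.2 h1
    have h3 : ((n : ℕ∞) : ENNReal) ≤ ENNReal.ofReal T := by
      rw [ENat.toENNReal_coe, ← ENNReal.ofReal_natCast]
      exact ENNReal.ofReal_le_ofReal hn
    exact absurd hω (not_lt.2 (h2.trans h3))
  refine (measure_mono hsub).trans ((law_lt_undecodableCount_le p hγb hγa hdec).trans
    (ENNReal.ofReal_le_ofReal ?_))
  rw [← Real.log_le_log_iff (Real.exp_pos _) hε, Real.log_exp, neg_div]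
  rw [one_div, Real.log_inv] at hdev
  linarith

end ChunkedCode

/-! ### Assembly -/

theorem mainTheorem5 :
    ∃ C : ℝ, 0 < C ∧ ∃ g : ℝ → ℝ → ℝ,
      -- `g γa γb` is `O(γb ^ 2)`
      (∀ η : ℝ, 0 < η → η < 1 → ∃ K : ℝ, ∀ γa γb : ℝ, 0 < γa → γa < 1 → 0 < γb → γb < 1 →
        (1 + γa) * γb ≤ η → |g γa γb| ≤ K * γb ^ 2) ∧
      ∀ (L : ℕ) [NeZero L] (p : Fin L → unitInterval) (γa γb γc : ℝ),
        (∀ i, 0 < p i) →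
        0 < γa → γa < 1 → 0 < γb → γb < 1 → 0 < γc → γc < 1 →
        (1 + γa) * γb < 1 →
        -- for each message size `k`: the vector space, the number and the size of the chunks,
        -- the precode, and the failure probability
        ∀ (F : ℕ → Type*) [∀ k, AddCommGroup (F k)] [∀ k, Module (ZMod 2) (F k)]
          (q α : ℕ → ℕ) [∀ k, NeZero (q k)]
          (E : ∀ k, ChunkedCode.Precode k (q k) (α k) (F k)) (ε : ℕ → ℝ),
          (∀ k, (E k).CorrectsErasures ((1 + γa) * γb)) →
          Tendsto (fun k : ℕ => (k : ℝ) / ((q k : ℝ) * (α k : ℝ))) atTop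
            (𝓝 (1 - (1 + γa) * γb)) →
          (∀ k, 0 < ε k ∧ ε k < 1) →
          (∀ᶠ k in atTop,
            C * max ((L : ℝ) / γc ^ 3 * Real.log ((L : ℝ) / (γb * γc)))
                ((L : ℝ) ^ 4 * Real.log ((L : ℝ) / γb)) ≤ (α k : ℝ)) →
          (fun k : ℕ => (α k : ℝ) ^ 2 / (γa ^ 2 * γb ^ 2)) =o[atTop]
            (fun k : ℕ => (k : ℝ) / Real.log (1 / ε k)) →
          ∀ᶠ k : ℕ in atTop,
            ChunkedCode.law L (q k) (α k) p
                {ω | ENNReal.ofReal ((1 + γc) * (1 + (1 + γa) * γb + g γa γb) *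
                      ((k : ℝ) / ⨅ i, (p i : ℝ))) <
                    (ChunkedCode.codingDelay (E k) ω : ENNReal)} ≤
              ENNReal.ofReal (ε k) := by
  -- `g` is chosen so that `1 + δ + g = (1 + 100 * γb ^ 2) / (1 - δ)`: the inverse of the precode
  -- rate, with the slack needed when the logarithm is small.
  refine ⟨30000, by norm_num, fun γa γb =>
    (((1 + γa) * γb) ^ 2 + 100 * γb ^ 2) / (1 - (1 + γa) * γb), fun η _ hη1 => ?_, ?_⟩
  · refine ⟨104 / (1 - η), fun γa γb hγa hγa1 hγb _ hδ => ?_⟩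
    have h1 : 0 < 1 - η := by linarith
    have h2 : 1 - η ≤ 1 - (1 + γa) * γb := by linarith
    rw [abs_of_nonneg (div_nonneg (by positivity) (h1.le.trans h2)), div_mul_eq_mul_div]
    have h3 : (1 + γa) ^ 2 ≤ 2 ^ 2 := pow_le_pow_left₀ (by linarith) (by linarith) 2
    refine div_le_div₀ (by positivity) ?_ h1 h2
    rw [mul_pow]
    nlinarith [mul_le_mul_of_nonneg_right h3 (sq_nonneg γb)]
  intro L _ p γa γb γc hp hγa hγa1 hγb hγb1 hγc hγc1 hδ F _ _ q α _ E ε hE hrate hε hα ho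
  beta_reduce
  obtain ⟨W, B, hW, hB, hBA, hdec⟩ :=
    ChunkedCode.exists_windows_law_not_chunkDecodable_le L hγb hγb1 hγc hγc1
  set δ := (1 + γa) * γb with hδdef
  have hδ0 : 0 < δ := by positivity
  have hδ1 : 0 < 1 - δ := by linarith
  have hL0 : (0 : ℝ) < L := by exact_mod_cast NeZero.pos L
  have hW0 : (0 : ℝ) < W := by exact_mod_cast hW
  set A := (1 + γc) * (1 + 100 * γb ^ 2) with hA
  -- The gap from `B` to `B'` pays for rounding the window length, the gap from `B'` to `A` for the
  -- rate reaching its limit only asymptotically.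
  obtain ⟨B', hBB', hB'A⟩ := exists_between hBA
  have hB' : 0 < B' := hB.trans hBB'
  set pm : ℝ := ⨅ i, (p i : ℝ) with hpm
  have hpm_le : ∀ i, pm ≤ p i := fun i => ciInf_le (Set.finite_range _).bddBelow i
  have hpm0 : 0 < pm := by
    obtain ⟨i, hi⟩ := exists_eq_ciInf_of_finite (f := fun i => (p i : ℝ))
    rw [hpm, ← hi]
    exact hp i
  have hpm1 : pm ≤ 1 := (hpm_le ⟨0, NeZero.pos L⟩).trans (p _).2.2
  have hA0 : 0 < A := by positivity
  have hrate1 : ∀ᶠ k : ℕ in atTop, (k : ℝ) / ((q k : ℝ) * (α k : ℝ)) < 1 :=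
    hrate.eventually_lt_const (by linarith)
  have hrate2 : ∀ᶠ k : ℕ in atTop, B' * (1 - δ) / A < (k : ℝ) / ((q k : ℝ) * (α k : ℝ)) :=
    hrate.eventually_const_lt (by rw [div_lt_iff₀ hA0]; nlinarith)
  have hlarge : ∀ᶠ k : ℕ in atTop, (W : ℝ) / (B' - B) ≤ k :=
    tendsto_natCast_atTop_atTop.eventually_ge_atTop _
  have hlittle := ho.bound (c := pm / (8 * L * B')) (by positivity)
  filter_upwards [hrate1, hrate2, hlarge, hlittle, hα, eventually_gt_atTop 0] with
    k hr1 hr2 hk hl hαk hk0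
  have hq0 : (0 : ℝ) < q k := by exact_mod_cast NeZero.pos (q k)
  have hα0 : (0 : ℝ) < α k := by
    -- For `α k = 0` the rate would be a division by zero, with value 0, below the positive lower
    -- bound `hr2`.
    rcases (Nat.cast_nonneg (α := ℝ) (α k)).eq_or_lt with h | h
    · rw [← h, mul_zero, div_zero] at hr2
      exact absurd hr2 (not_lt.2 (by positivity))
    · exact h
  have hN0 : 0 < (q k : ℝ) * α k := mul_pos hq0 hα0
  have hk0' : (0 : ℝ) < k := by exact_mod_cast hk0
  rw [div_lt_one hN0] at hr1
  rw [lt_div_iff₀ hN0, div_mul_eq_mul_div, div_lt_iff₀ hA0] at hr2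
  set w : ℕ := ⌈B * (q k * α k) / (pm * W)⌉₊ with hw
  have hwl : B * (q k * α k) / (pm * W) ≤ w := Nat.le_ceil _
  have hnle : ((W * w : ℕ) : ℝ) ≤ B' * (q k * α k) / pm := by
    have h1 : (w : ℝ) ≤ B * (q k * α k) / (pm * W) + 1 :=
      (Nat.ceil_lt_add_one (by positivity)).le
    -- Rounding up the window length costs at most `W` instants, which is covered for large `k`
    -- because `k < q k * α k`.
    have h2 : (W : ℝ) ≤ (B' - B) * (q k * α k) / pm := by
      rw [le_div_iff₀ hpm0]
      rw [div_le_iff₀ (by linarith)] at hk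
      nlinarith [mul_le_mul_of_nonneg_left hr1.le (sub_nonneg.2 hBB'.le),
        mul_le_mul_of_nonneg_left hpm1 hW0.le]
    push_cast
    calc (W : ℝ) * w ≤ W * (B * (q k * α k) / (pm * W) + 1) := by gcongr
      _ = B * (q k * α k) / pm + W := by field_simp
      _ ≤ B * (q k * α k) / pm + (B' - B) * (q k * α k) / pm := by gcongr
      _ = B' * (q k * α k) / pm := by ring
  have hn0 : (0 : ℝ) < ((W * w : ℕ) : ℝ) := by
    have : 0 < w := Nat.ceil_pos.2 (by positivity)
    exact_mod_cast Nat.mul_pos hW this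
  refine ChunkedCode.law_lt_codingDelay_le (n := W * w) p hγa.le hγb.le (hε k).1 (hE k)
    (fun c => hdec (q k) (α k) w p c ?_ fun i => ?_) (hnle.trans ?_) ?_
  · exact le_trans (mul_le_mul_of_nonneg_left (le_max_left _ _) (by norm_num)) hαk
  · calc B * α k / W = B * (q k * α k) / (pm * W) * (pm / q k) := by field_simp
      _ ≤ w * (p i / q k) := by
        gcongr
        exact hpm_le i
  · have h1 : (1 + γc) * (1 + δ + (δ ^ 2 + 100 * γb ^ 2) / (1 - δ)) = A / (1 - δ) := by
      rw [hA]
      field_simp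
      ring
    rw [h1, ← mul_div_assoc, div_le_div_iff_of_pos_right hpm0, div_mul_eq_mul_div,
      le_div_iff₀ hδ1]
    linarith
  · have hlog : 0 < Real.log (1 / ε k) :=
      Real.log_pos (one_lt_one_div (hε k).1 (hε k).2)
    rw [Real.norm_of_nonneg (by positivity), Real.norm_of_nonneg (by positivity),
      div_le_iff₀ (by positivity), mul_div_assoc', div_mul_eq_mul_div, le_div_iff₀ hlog] at hl
    have h1 : (γa * γb * q k) ^ 2 / (8 * (L * (B' * (q k * α k) / pm))) ≤
        (γa * γb * q k) ^ 2 / (8 * (L * ((W * w : ℕ) : ℝ))) := by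
      gcongr
    refine le_trans ?_ h1
    -- The exponent is linear in `q k * α k > k`; its coefficient explains the constant used in
    -- `hlittle`.
    have h2 : (γa * γb * q k) ^ 2 / (8 * (L * (B' * (q k * α k) / pm))) =
        pm / (8 * L * B') * (q k * α k) * (γa ^ 2 * γb ^ 2) / (α k) ^ 2 := by
      field_simp
    rw [h2, le_div_iff₀ (by positivity), mul_comm]
    refine hl.trans ?_
    gcongr
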